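/- Let $\mathbb D=\{z\in\mathbb C:|z|<1\}$, let $H(\mathbb D)$ be the space of analytic functions on $\mathbb D$ with the topology of uniform convergence on compact subsets, and let $dA=\frac{dx\,dy}{\pi}$. For $f\in H(\mathbb D)$, $1<s<\infty$ and $0\le r<1$ put $M_s(r,f')=\left(\frac1{2\pi}\int_0^{2\pi}|f'(re^{i\theta})|^s\,d\theta\right)^{1/s}$. The mean Lipschitz space is $$\Lambda^s_{1/s}=\Big\{f\in H(\mathbb D):\ \sup_{0\le r<1}(1-r)^{1-1/s}M_s(r,f')<\infty\Big\},$$ and the Bloch space is $\mathcal B=\{f\in H(\mathbb D):\ \sup_{z\in\mathbb D}(1-|z|^2)|f'(z)|<\infty\}$. For $1<p<\infty$ the analytic Besov space $B_p$ consists of all $f\in H(\mathbb D)$ with $$\|f\|_{B_p}=|f(0)|+\Big(\int_{\mathbb D}|f'(z)|^p(1-|z|)^{p-2}\,dA(z)\Big)^{1/p}<\infty,$$ and $B_1$ consists of all $f\in H(\mathbb D)$ with $$\|f\|_{B_1}=|f(0)|+|f'(0)|+\int_{\mathbb D}|f''(z)|\,dA(z)<\infty.$$ For a finite positive Borel measure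 $\mu$ on $[0,1)$ with moments $\mu_n=\int_{[0,1)}t^n\,d\mu(t)$, for $0<\alpha<\infty$ and $f(z)=\sum_{n\ge0}a_nz^n\in H(\mathbb D)$, define $$\mathcal C_{\mu,\alpha}(f)(z)=\sum_{n=0}^\infty\Big(\mu_n\sum_{k=0}^n\frac{\Gamma(n-k+\alpha)}{\Gamma(\alpha)\,(n-k)!}\,a_k\Big)z^n,\qquad z\in\mathbb D.$$ **Theorem.** Let $0<\alpha<\infty$, $1<s<\infty$ and $\max\{1,\frac1\alpha\}\le p<\infty$. Let $\mu$ be a finite positive Borel measure on $[0,1)$, and let $X$ be a Banach space that is a linear subspace of $H(\mathbb D)$, with continuous inclusion $X\hookrightarrow H(\mathbb D)$, such that $\Lambda^s_{1/s}\subset X\subset\mathcal B$ (as sets). Then the following are equivalent: 1. $\mathcal C_{\mu,\alpha}$ is a bounded operator from $X$ to $B_p$. 2. $\mathcal C_{\mu,\alpha}$ is a compact operator from $X$ to $B_p$. 3. $\displaystyle\sum_{n=0}^\infty (n+1)^{p\alpha-1}\mu_n^p\log^p(n+2)<\infty.$ -/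

import Mathlib

open MeasureTheory
open scoped ENNReal

noncomputable section

namespace CesaroBesov

/-- The open unit disk of the complex plane. -/
abbrev disk : Set ℂ := Metric.ball (0 : ℂ) 1

/-- The space `H(𝔻)` of analytic functions in the unit disk. Each such function is represented by
the function on `ℂ` that agrees with it on the disk and vanishes off the disk, so that two elements
are equal exactly when they agree on the disk. -/
def Hol : Submodule ℂ (ℂ → ℂ) where
  carrier := {f | DifferentiableOn ℂ f disk ∧ ∀ z ∉ disk, f z = 0}
  add_mem' := by
    rintro f g ⟨hf, hf0⟩ ⟨hg, hg0⟩
    exact ⟨hf.add hg, fun z hz => by simp [hf0 z hz, hg0 z hz]⟩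
  zero_mem' := ⟨differentiableOn_const (0 : ℂ), fun _ _ => rfl⟩
  smul_mem' := by
    rintro c f ⟨hf, hf0⟩
    exact ⟨hf.const_smul c, fun z hz => by simp [hf0 z hz]⟩

instance : CoeFun Hol (fun _ => ℂ → ℂ) := ⟨fun f => f.1⟩

/-- The Bloch space: `sup (1 - |z|²) |f'(z)| < ∞`. -/
def bloch : Set Hol :=
  {f | ∃ C : ℝ, ∀ z ∈ disk, (1 - ‖z‖ ^ 2) * ‖deriv f z‖ ≤ C}

/-- The integral mean `M_s(r, g)` of order `s` over the circle of radius `r`. -/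
def integralMean (s r : ℝ) (g : ℂ → ℂ) : ℝ :=
  ((2 * Real.pi)⁻¹ * ∫ θ in (0 : ℝ)..2 * Real.pi, ‖g (circleMap 0 r θ)‖ ^ s) ^ (1 / s)

/-- The mean Lipschitz space `Λ^s_β`: the analytic functions in the disk with
`sup_{0 ≤ r < 1} (1 - r)^(1 - β) M_s(r, f') < ∞`. -/
def meanLipschitz (s β : ℝ) : Set Hol :=
  {f | ∃ C : ℝ, ∀ r : ℝ, 0 ≤ r → r < 1 → (1 - r) ^ (1 - β) * integralMean s r (deriv f) ≤ C}

/-- Normalized area measure `dA = dx dy / π` on the disk. -/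
def area : Measure ℂ := ENNReal.ofReal (Real.pi⁻¹) • volume.restrict disk

/-- The integral part of the Besov norm: `(∫ |f'|^p (1 - |z|)^(p - 2) dA)^(1/p)` if `p ≠ 1`, and
`∫ |f''| dA` if `p = 1`. -/
def besovIntegral (p : ℝ) (f : ℂ → ℂ) : ℝ≥0∞ :=
  if p = 1 then ∫⁻ z, ‖deriv (deriv f) z‖ₑ ∂area
  else (∫⁻ z, ‖deriv f z‖ₑ ^ p * ENNReal.ofReal ((1 - ‖z‖) ^ (p - 2)) ∂area) ^ (1 / p)

/-- The Besov norm: `|f(0)| + (∫ |f'|^p (1 - |z|)^(p - 2) dA)^(1/p)` if `p ≠ 1`, and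
`|f(0)| + |f'(0)| + ∫ |f''| dA` if `p = 1`. -/
def besovNorm (p : ℝ) (f : ℂ → ℂ) : ℝ :=
  ‖f 0‖ + (if p = 1 then ‖deriv f 0‖ else 0) + (besovIntegral p f).toReal

lemma zero_mem_disk : (0 : ℂ) ∈ disk := by simp

lemma ae_area_mem : ∀ᵐ z ∂area, z ∈ disk := by
  unfold area
  exact Measure.ae_smul_measure (ae_restrict_mem Metric.isOpen_ball.measurableSet) _

lemma Hol.differentiableAt (f : Hol) {z : ℂ} (hz : z ∈ disk) : DifferentiableAt ℂ f z :=
  f.2.1.differentiableAt (Metric.isOpen_ball.mem_nhds hz)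

lemma Hol.differentiableAt_deriv (f : Hol) {z : ℂ} (hz : z ∈ disk) :
    DifferentiableAt ℂ (deriv f) z :=
  (f.2.1.deriv Metric.isOpen_ball).differentiableAt (Metric.isOpen_ball.mem_nhds hz)

lemma Hol.deriv_add (f g : Hol) {z : ℂ} (hz : z ∈ disk) :
    deriv (f + g : Hol) z = deriv f z + deriv g z :=
  _root_.deriv_add (Hol.differentiableAt f hz) (Hol.differentiableAt g hz)

lemma Hol.deriv_deriv_add (f g : Hol) {z : ℂ} (hz : z ∈ disk) :
    deriv (deriv (f + g : Hol)) z = deriv (deriv f) z + deriv (deriv g) z := by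
  have h : deriv (f + g : Hol) =ᶠ[nhds z] deriv f + deriv g := by
    filter_upwards [Metric.isOpen_ball.mem_nhds hz] with w hw
    exact Hol.deriv_add f g hw
  rw [h.deriv_eq]
  exact _root_.deriv_add (Hol.differentiableAt_deriv f hz) (Hol.differentiableAt_deriv g hz)

lemma Hol.deriv_smul (c : ℂ) (f : Hol) : deriv (c • f : Hol) = c • deriv f := by
  funext z
  exact deriv_const_smul_field c (f : ℂ → ℂ)

lemma besovIntegral_add_le {p : ℝ} (hp : 1 ≤ p) (f g : Hol) :
    besovIntegral p (f + g : Hol) ≤ besovIntegral p f + besovIntegral p g := by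
  unfold besovIntegral
  split_ifs with h
  · rw [← lintegral_add_left (measurable_deriv (deriv f)).enorm]
    apply lintegral_mono_ae
    filter_upwards [ae_area_mem] with z hz
    rw [Hol.deriv_deriv_add f g hz]
    exact enorm_add_le _ _
  · have hp0 : 0 < p := by linarith
    have hw : Measurable fun z : ℂ => ENNReal.ofReal ((1 - ‖z‖) ^ (p - 2)) := by fun_prop
    have key : ∀ u : ℂ → ℝ≥0∞, Measurable u →
        ∫⁻ z, u z ^ p * ENNReal.ofReal ((1 - ‖z‖) ^ (p - 2)) ∂area =
        ∫⁻ z, u z ^ p ∂(area.withDensity fun z => ENNReal.ofReal ((1 - ‖z‖) ^ (p - 2))) := by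
      intro u hu
      rw [lintegral_withDensity_eq_lintegral_mul _ hw (hu.pow_const p)]
      simp [mul_comm]
    have hmf : Measurable fun z => ‖deriv f z‖ₑ := (measurable_deriv f).enorm
    have hmg : Measurable fun z => ‖deriv g z‖ₑ := (measurable_deriv g).enorm
    calc
      _ ≤ (∫⁻ z, (‖deriv f z‖ₑ + ‖deriv g z‖ₑ) ^ p *
            ENNReal.ofReal ((1 - ‖z‖) ^ (p - 2)) ∂area) ^ (1 / p) := by
        apply ENNReal.rpow_le_rpow _ (by positivity)
        apply lintegral_mono_ae
        filter_upwards [ae_area_mem] with z hz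
        rw [Hol.deriv_add f g hz]
        gcongr
        exact enorm_add_le _ _
      _ ≤ _ := by
        rw [key (fun z => ‖deriv f z‖ₑ + ‖deriv g z‖ₑ) (hmf.add hmg), key _ hmf, key _ hmg]
        exact ENNReal.lintegral_Lp_add_le hmf.aemeasurable hmg.aemeasurable hp

lemma besovIntegral_smul {p : ℝ} (hp : 1 ≤ p) (c : ℂ) (f : Hol) :
    besovIntegral p (c • f : Hol) = ‖c‖ₑ * besovIntegral p f := by
  unfold besovIntegral
  have hp0 : 0 < p := by linarith
  rw [Hol.deriv_smul]
  split_ifs with h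
  · rw [← lintegral_const_mul _ (measurable_deriv (deriv f)).enorm]
    congr 1
    funext z
    have : deriv (c • deriv f) z = c * deriv (deriv f) z :=
      deriv_const_smul_field c (deriv f)
    rw [this, enorm_mul]
  · have h1 : ∀ z : ℂ, ‖(c • deriv f) z‖ₑ ^ p * ENNReal.ofReal ((1 - ‖z‖) ^ (p - 2)) =
        ‖c‖ₑ ^ p * (‖deriv f z‖ₑ ^ p * ENNReal.ofReal ((1 - ‖z‖) ^ (p - 2))) := by
      intro z
      rw [Pi.smul_apply, smul_eq_mul, enorm_mul, ENNReal.mul_rpow_of_nonneg _ _ hp0.le, mul_assoc]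
    simp_rw [h1]
    have hm : Measurable fun z : ℂ =>
        ‖deriv f z‖ₑ ^ p * ENNReal.ofReal ((1 - ‖z‖) ^ (p - 2)) :=
      ((measurable_deriv f).enorm.pow_const p).mul (by fun_prop)
    rw [lintegral_const_mul _ hm, ENNReal.mul_rpow_of_nonneg _ _ (by positivity),
      ← ENNReal.rpow_mul, mul_one_div_cancel hp0.ne', ENNReal.rpow_one]

lemma eq_zero_of_ae_area {u : ℂ → ℂ} (hu : ContinuousOn u disk) (h : ∀ᵐ z ∂area, u z = 0) :
    ∀ z ∈ disk, u z = 0 := by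
  have h' : ∀ᵐ z ∂(volume.restrict disk), u z = 0 := by
    unfold area at h
    rwa [Measure.ae_ennreal_smul_measure_iff] at h
    simp [Real.pi_pos]
  exact Measure.eqOn_open_of_ae_eq (g := fun _ => (0 : ℂ)) h' Metric.isOpen_ball hu
    continuousOn_const

lemma eq_zero_of_deriv_eq_zero {u : ℂ → ℂ} (hu : DifferentiableOn ℂ u disk)
    (h : ∀ z ∈ disk, deriv u z = 0) (h0 : u 0 = 0) : ∀ z ∈ disk, u z = 0 := by
  intro z hz
  rw [← h0]
  exact Metric.isOpen_ball.is_const_of_deriv_eq_zero (convex_ball _ _).isPreconnected hu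
    (fun w hw => h w hw) hz zero_mem_disk

lemma eq_zero_of_besovNorm {p : ℝ} (hp : 1 ≤ p) (f : Hol) (hfin : besovIntegral p f < ∞)
    (h : besovNorm p f = 0) : f = 0 := by
  have hp0 : 0 < p := by linarith
  unfold besovNorm at h
  have hA : (0 : ℝ) ≤ if p = 1 then ‖deriv f 0‖ else 0 := by split_ifs <;> positivity
  have hI0 : (0 : ℝ) ≤ (besovIntegral p f).toReal := ENNReal.toReal_nonneg
  have hf0 : f 0 = 0 := by
    rw [← norm_eq_zero]; linarith [norm_nonneg (f 0)]
  have hI : besovIntegral p f = 0 := by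
    have : (besovIntegral p f).toReal = 0 := by linarith [norm_nonneg (f 0)]
    exact ((ENNReal.toReal_eq_zero_iff _).1 this).resolve_right hfin.ne
  have hd : ∀ z ∈ disk, deriv f z = 0 := by
    have hdd : DifferentiableOn ℂ (deriv f) disk := f.2.1.deriv Metric.isOpen_ball
    unfold besovIntegral at hI
    split_ifs at hI hA h with hp1
    · have h1 : deriv f 0 = 0 := by
        rw [← norm_eq_zero]; linarith [norm_nonneg (f 0), norm_nonneg (deriv f 0)]
      rw [lintegral_eq_zero_iff (measurable_deriv (deriv f)).enorm] at hI
      refine eq_zero_of_deriv_eq_zero hdd ?_ h1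
      refine eq_zero_of_ae_area (hdd.deriv Metric.isOpen_ball).continuousOn ?_
      filter_upwards [hI] with z hz
      simpa using hz
    · rw [ENNReal.rpow_eq_zero_iff_of_pos (by positivity)] at hI
      have hm : Measurable fun z : ℂ =>
          ‖deriv f z‖ₑ ^ p * ENNReal.ofReal ((1 - ‖z‖) ^ (p - 2)) :=
        ((measurable_deriv f).enorm.pow_const p).mul (by fun_prop)
      rw [lintegral_eq_zero_iff hm] at hI
      refine eq_zero_of_ae_area hdd.continuousOn ?_
      filter_upwards [hI, ae_area_mem] with z hz hzd
      have hpos : 0 < (1 - ‖z‖) ^ (p - 2) := by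
        apply Real.rpow_pos_of_pos
        have : ‖z‖ < 1 := by simpa using hzd
        linarith
      have hne : ENNReal.ofReal ((1 - ‖z‖) ^ (p - 2)) ≠ 0 := by simpa using hpos
      have hz' := (mul_eq_zero.1 hz).resolve_right hne
      rw [ENNReal.rpow_eq_zero_iff_of_pos hp0] at hz'
      simpa using hz'
  apply Subtype.ext
  funext z
  by_cases hz : z ∈ disk
  · exact eq_zero_of_deriv_eq_zero f.2.1 hd hf0 z hz
  · exact f.2.2 z hz

/-- The analytic Besov space `B_p`, `1 ≤ p < ∞`, as a linear subspace of `H(𝔻)`. -/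
def besovSubmodule (p : ℝ) [hp : Fact (1 ≤ p)] : Submodule ℂ Hol where
  carrier := {f | besovIntegral p f < ∞}
  add_mem' := by
    intro f g hf hg
    exact (besovIntegral_add_le hp.out f g).trans_lt (ENNReal.add_lt_top.2 ⟨hf, hg⟩)
  zero_mem' := by
    have := besovIntegral_smul hp.out 0 (0 : Hol)
    rw [zero_smul] at this
    change besovIntegral p (0 : Hol) < ∞
    rw [this]
    simp
  smul_mem' := by
    intro c f hf
    change besovIntegral p (c • f : Hol) < ∞
    rw [besovIntegral_smul hp.out]
    exact ENNReal.mul_lt_top enorm_lt_top hf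

/-- The analytic Besov space `B_p` as a type; it carries the topology of the Besov norm. -/
def Besov (p : ℝ) [Fact (1 ≤ p)] : Type := besovSubmodule p

namespace Besov

variable (p : ℝ) [hp : Fact (1 ≤ p)]

instance : AddCommGroup (Besov p) := inferInstanceAs (AddCommGroup (besovSubmodule p))

instance : Module ℂ (Besov p) := inferInstanceAs (Module ℂ (besovSubmodule p))

/-- The inclusion of `B_p` in `H(𝔻)`. -/
def toHol : Besov p →ₗ[ℂ] Hol := (besovSubmodule p).subtype

instance : CoeFun (Besov p) (fun _ => ℂ → ℂ) := ⟨fun f => toHol p f⟩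

instance : Norm (Besov p) := ⟨fun f => besovNorm p f⟩

lemma core : NormedSpace.Core ℂ (Besov p) where
  norm_nonneg f := by
    change 0 ≤ besovNorm p f
    unfold besovNorm
    split_ifs <;> positivity
  norm_smul c f := by
    change besovNorm p (c • toHol p f : Hol) = ‖c‖ * besovNorm p (toHol p f)
    unfold besovNorm
    rw [besovIntegral_smul hp.out, Hol.deriv_smul, ENNReal.toReal_mul, toReal_enorm]
    have h0 : ‖(c • toHol p f : Hol) 0‖ = ‖c‖ * ‖toHol p f 0‖ := norm_mul _ _
    rw [h0, Pi.smul_apply, norm_smul]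
    split_ifs <;> ring
  norm_triangle f g := by
    change besovNorm p (toHol p f + toHol p g : Hol) ≤
      besovNorm p (toHol p f) + besovNorm p (toHol p g)
    unfold besovNorm
    have hf : besovIntegral p (toHol p f) < ∞ := f.2
    have hg : besovIntegral p (toHol p g) < ∞ := g.2
    have h0 : ‖(toHol p f + toHol p g : Hol) 0‖ ≤ ‖toHol p f 0‖ + ‖toHol p g 0‖ :=
      norm_add_le _ _
    have h1 := ENNReal.toReal_mono (ENNReal.add_lt_top.2 ⟨hf, hg⟩).ne
      (besovIntegral_add_le hp.out (toHol p f) (toHol p g))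
    rw [ENNReal.toReal_add hf.ne hg.ne] at h1
    rw [Hol.deriv_add _ _ zero_mem_disk]
    have h2 := norm_add_le (deriv (toHol p f) 0) (deriv (toHol p g) 0)
    split_ifs <;> linarith
  norm_eq_zero_iff f := by
    constructor
    · intro h
      exact Subtype.ext (eq_zero_of_besovNorm hp.out (toHol p f) f.2 h)
    · rintro rfl
      have hi := besovIntegral_smul hp.out 0 (0 : Hol)
      rw [zero_smul] at hi
      have hd := Hol.deriv_smul 0 (0 : Hol)
      rw [zero_smul] at hd
      change besovNorm p (0 : Hol) = 0
      unfold besovNorm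
      rw [hi, hd]
      simp

instance : NormedAddCommGroup (Besov p) := NormedAddCommGroup.ofCore (core p)

instance : NormedSpace ℂ (Besov p) := NormedSpace.ofCore (core p)

end Besov

/-- The `n`-th moment `μ_n = ∫ t^n dμ(t)` of a measure on `[0, 1)`. -/
def moment (μ : Measure (Set.Ico (0 : ℝ) 1)) (n : ℕ) : ℝ := ∫ t, (t : ℝ) ^ n ∂μ

/-- The `k`-th Taylor coefficient of `f` at the origin. -/
def taylorCoeff (f : Hol) (k : ℕ) : ℂ := iteratedDeriv k f 0 / (k.factorial : ℂ)

/-- The generalized Cesàro-like operator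
`C_{μ,α}(f)(z) = ∑_n (μ_n ∑_{k ≤ n} Γ(n - k + α) / (Γ(α) (n - k)!) a_k) z^n`, where the `a_k` are
the Taylor coefficients of `f`. The series converges absolutely at every point of the disk. -/
def cesaro (μ : Measure (Set.Ico (0 : ℝ) 1)) (α : ℝ) (f : Hol) (z : ℂ) : ℂ :=
  ∑' n : ℕ, ((moment μ n : ℂ) * ∑ k ∈ Finset.range (n + 1),
    ((Real.Gamma (((n - k : ℕ) : ℝ) + α) / (Real.Gamma α * ((n - k).factorial : ℝ)) : ℝ) : ℂ) *
      taylorCoeff f k) * z ^ n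

/-- `ι` exhibits the normed space `X` as a linear subspace of `H(𝔻)` whose norm topology is finer
than that of uniform convergence on compact subsets of the disk. -/
def IsAnalyticFunctionSpace {X : Type*} [NormedAddCommGroup X] [NormedSpace ℂ X]
    (ι : X →ₗ[ℂ] Hol) : Prop :=
  Function.Injective ι ∧
    ∀ K : Set ℂ, IsCompact K → K ⊆ disk → ∃ C : ℝ, ∀ x : X, ∀ z ∈ K, ‖ι x z‖ ≤ C * ‖x‖

/-- `C_{μ,α}` maps `X` into `B_p` and is bounded as a linear operator `X → B_p`. -/
def CesaroBounded {X : Type*} [NormedAddCommGroup X] [NormedSpace ℂ X] (ι : X →ₗ[ℂ] Hol)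
    (μ : Measure (Set.Ico (0 : ℝ) 1)) (α p : ℝ) [Fact (1 ≤ p)] : Prop :=
  ∃ T : X →L[ℂ] Besov p, ∀ x : X, ∀ z ∈ disk, T x z = cesaro μ α (ι x) z

/-- `C_{μ,α}` maps `X` into `B_p` and is compact as a linear operator `X → B_p`. -/
def CesaroCompact {X : Type*} [NormedAddCommGroup X] [NormedSpace ℂ X] (ι : X →ₗ[ℂ] Hol)
    (μ : Measure (Set.Ico (0 : ℝ) 1)) (α p : ℝ) [Fact (1 ≤ p)] : Prop :=
  ∃ T : X →L[ℂ] Besov p, (∀ x : X, ∀ z ∈ disk, T x z = cesaro μ α (ι x) z) ∧ IsCompactOperator T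

end CesaroBesov

end

noncomputable section

namespace CesaroBesov

/-! ### The kernel `(1 - z)^(-α)` and its logarithmic companion -/

/-! Writing `μ_n` as an integral and recognising a Cauchy product gives `C_{μ,α}(f)(z) = ∫ f(tz) (1
- tz)^(-α) dμ(t)` (`cesaro_eq_cesaroIntegral`). With `j = besovOrder p` (2 if `p = 1`, else 1),
membership of `F` in `B_p` means `∫ |F^(j)|^p (1 - |z|)^(jp - 2) dA < ∞`, where always `jp > 1`.
Condition 3 is equivalent to its dyadic form `∑ 2^(mαp) (m+1)^p μ_{2^m}^p < ∞`, and both directions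
work with that form.

Sufficiency. A Bloch function grows at most like `log (1/(1 - |z|))`, and Cauchy estimates bound the
`j`-th derivative of `f(z) (1 - z)^(-α)` (`norm_iteratedDeriv_lift_le`). Sorting `t` by its distance
to 1 bounds the `j`-th derivative of the image by a `majorant` that is the same for all `f` in a
Bloch ball, up to a constant: a sum of tail masses of `μ` times explicit kernels in `arg z`.
Condition 3 makes the majorant `p`-integrable for the Besov weight (`lintegral_majorant_lt_top`). A
normal-family argument (`exists_subseq_normalConvergence`) and dominated convergence then show that
the image of a Bloch ball is compact in `B_p`. By the uniform boundedness principle the unit ball of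
`X` lies in such a ball (`exists_forall_mem_blochBall`).

Necessity. The function `1 - log (1 - z)` lies in every `Λ^s_{1/s}` with `s > 1`, hence in `X`. At
the points `1 - 2^(-m)` the integral for its image has a nonnegative integrand, so nothing cancels
and the `j`-th derivative dominates `2^(m(α+j)) (m+1) μ_{2^m}`
(`exists_moment_le_norm_iteratedDeriv`). Area means over disjoint disks about these points turn
finiteness of the Besov integral into the dyadic series (`summable_norm_rpow_of_lintegral_lt_top`).

Compactness trivially gives boundedness, which closes the cycle. -/

lemma mem_disk {z : ℂ} : z ∈ disk ↔ ‖z‖ < 1 := mem_ball_zero_iff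

lemma disk_mem_nhds {z : ℂ} (hz : z ∈ disk) : disk ∈ nhds z := Metric.isOpen_ball.mem_nhds hz

/-- The kernel `(1 - z)^(-α)`. -/
def powKernel (α : ℝ) (z : ℂ) : ℂ := (1 - z) ^ ((-α : ℝ) : ℂ)

lemma norm_powKernel (α : ℝ) (z : ℂ) : ‖powKernel α z‖ = ‖1 - z‖ ^ (-α) :=
  Complex.norm_cpow_real _ _

lemma one_sub_norm_le (z : ℂ) : 1 - ‖z‖ ≤ ‖1 - z‖ := by
  simpa using norm_sub_norm_le (1 : ℂ) z

lemma one_sub_mem_slitPlane {z : ℂ} (hz : z ∈ disk) : 1 - z ∈ Complex.slitPlane := by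
  left
  have h1 := Complex.re_le_norm z
  have h2 := mem_disk.1 hz
  simp only [Complex.sub_re, Complex.one_re]
  linarith

lemma hasDerivAt_powKernel (α : ℝ) {z : ℂ} (hz : 1 - z ∈ Complex.slitPlane) :
    HasDerivAt (powKernel α) (α * powKernel (α + 1) z) z := by
  have h := ((hasDerivAt_id z).const_sub 1).cpow_const (c := ((-α : ℝ) : ℂ)) hz
  refine h.congr_deriv ?_
  have he : ((-(α + 1) : ℝ) : ℂ) = ((-α : ℝ) : ℂ) - 1 := by push_cast; ring
  simp only [powKernel, id, he]
  push_cast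
  ring

lemma differentiableOn_powKernel (α : ℝ) : DifferentiableOn ℂ (powKernel α) disk := fun _ hz =>
  (hasDerivAt_powKernel α (one_sub_mem_slitPlane hz)).differentiableAt.differentiableWithinAt

lemma powKernel_div (α : ℝ) {z : ℂ} (hz : 1 - z ≠ 0) :
    powKernel α z / (1 - z) = powKernel (α + 1) z := by
  have he : ((-(α + 1) : ℝ) : ℂ) = ((-α : ℝ) : ℂ) - 1 := by push_cast; ring
  rw [powKernel, powKernel, he, Complex.cpow_sub _ _ hz, Complex.cpow_one]

lemma iteratedDeriv_powKernel {α : ℝ} (hα : 0 < α) (n : ℕ) :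
    ∀ z ∈ disk, iteratedDeriv n (powKernel α) z =
      ((Real.Gamma (n + α) / Real.Gamma α : ℝ) : ℂ) * powKernel (α + n) z := by
  induction n with
  | zero => intro z _; simp [(Real.Gamma_pos_of_pos hα).ne']
  | succ n ih =>
    intro z hz
    have hev : iteratedDeriv n (powKernel α) =ᶠ[nhds z] fun z =>
        ((Real.Gamma (n + α) / Real.Gamma α : ℝ) : ℂ) * powKernel (α + n) z := by
      filter_upwards [disk_mem_nhds hz] with w hw using ih w hw
    rw [iteratedDeriv_succ, hev.deriv_eq,
      ((hasDerivAt_powKernel (α + n) (one_sub_mem_slitPlane hz)).const_mul _).deriv]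
    have hG : Real.Gamma ((n + 1 : ℕ) + α) = (n + α) * Real.Gamma (n + α) := by
      rw [← Real.Gamma_add_one (by positivity)]
      congr 1
      push_cast
      ring
    rw [hG]
    have he : α + ((n + 1 : ℕ) : ℝ) = α + n + 1 := by push_cast; ring
    rw [he]
    push_cast
    ring

/-- The function `(1 - z)^(-α) (a (1 - log (1 - z)) + b)`. -/
def logKernel (α a b : ℝ) (z : ℂ) : ℂ := powKernel α z * (a * (1 - Complex.log (1 - z)) + b)

lemma hasDerivAt_logKernel (α a b : ℝ) {z : ℂ} (hz : z ∈ disk) :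
    HasDerivAt (logKernel α a b) (logKernel (α + 1) (α * a) (α * b + a) z) z := by
  have hs := one_sub_mem_slitPlane hz
  have h0 := Complex.slitPlane_ne_zero hs
  have hl := ((hasDerivAt_id z).const_sub 1).clog hs
  have h := (hasDerivAt_powKernel α hs).mul (((hl.const_sub 1).const_mul (a : ℂ)).add_const (b : ℂ))
  refine h.congr_deriv ?_
  simp only [logKernel, ← powKernel_div α h0, id]
  push_cast
  field_simp
  ring

/-- Differentiation preserves the shape and raises the exponent by one. The signs `a > 0`, `b ≥ 0`
are the point: they make all derivatives positive on `[0, 1)`, which yields the lower bound for the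
test function. -/
lemma exists_iteratedDeriv_logKernel {α : ℝ} (hα : 0 < α) (j : ℕ) :
    ∃ a b : ℝ, 0 < a ∧ 0 ≤ b ∧ ∀ z ∈ disk,
      iteratedDeriv j (logKernel α 1 0) z = logKernel (α + j) a b z := by
  induction j with
  | zero => exact ⟨1, 0, one_pos, le_rfl, fun z _ => by simp⟩
  | succ j ih =>
    obtain ⟨a, b, ha, hb, h⟩ := ih
    refine ⟨(α + j) * a, (α + j) * b + a, by positivity, by positivity, fun z hz => ?_⟩
    have hev : iteratedDeriv j (logKernel α 1 0) =ᶠ[nhds z] logKernel (α + j) a b := by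
      filter_upwards [disk_mem_nhds hz] with w hw using h w hw
    rw [iteratedDeriv_succ, hev.deriv_eq, (hasDerivAt_logKernel _ _ _ hz).deriv]
    push_cast
    rw [add_assoc]

lemma logKernel_ofReal (α a b : ℝ) {x : ℝ} (hx : x < 1) :
    logKernel α a b x = (((1 - x) ^ (-α) * (a * (1 - Real.log (1 - x)) + b) : ℝ) : ℂ) := by
  have h : (0 : ℝ) ≤ 1 - x := by linarith
  rw [logKernel, powKernel]
  push_cast [Complex.ofReal_cpow h, Complex.ofReal_log h]
  ring

/-- The lower bound `|1 - r e^{iθ}| ≥ |θ| / π`. -/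
lemma abs_div_pi_le_norm_one_sub {r θ : ℝ} (hr0 : 0 ≤ r) (hr : r ≤ 1) (hθ : |θ| ≤ Real.pi) :
    |θ| / Real.pi ≤ ‖1 - r * Complex.exp (Complex.I * θ)‖ := by
  have hpi := Real.pi_pos
  have h1 : 2 * |θ| / Real.pi ≤ ‖Complex.exp (Complex.I * θ) - 1‖ := by
    rw [Complex.norm_exp_I_mul_ofReal_sub_one, Real.norm_eq_abs, abs_mul, abs_two]
    have h := Real.mul_le_sin (x := |θ| / 2) (by positivity) (by linarith)
    have h2 : |Real.sin (θ / 2)| = |Real.sin (|θ| / 2)| := by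
      rcases abs_cases θ with ⟨h, _⟩ | ⟨h, _⟩ <;> rw [h]
      rw [neg_div, Real.sin_neg, abs_neg]
    have h3 := le_abs_self (Real.sin (|θ| / 2))
    have h4 : 2 * |θ| / Real.pi = 2 * (2 / Real.pi * (|θ| / 2)) := by ring
    rw [h2, h4]
    linarith
  set e := Complex.exp (Complex.I * θ) with he
  have hn : ‖e‖ = 1 := Complex.norm_exp_I_mul_ofReal θ
  have h2 := one_sub_norm_le ((r : ℂ) * e)
  have hr' : ‖(r : ℂ) * e‖ = r := by simp [hn, abs_of_nonneg hr0]
  -- Since also `1 - r ≤ |1 - re|`, this gives `|e - 1| ≤ 2 |1 - re|`; the factor 2 cancels against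
  -- Jordan's bound `2|θ|/π ≤ |e - 1|`.
  have h3 : ‖e - 1‖ ≤ ‖1 - r * e‖ + (1 - r) := by
    have : e - 1 = -(1 - r * e) + ((1 - r : ℝ) : ℂ) * e := by push_cast; ring
    rw [this]
    refine (norm_add_le _ _).trans ?_
    rw [norm_neg, norm_mul, hn, Complex.norm_real, Real.norm_eq_abs, abs_of_nonneg (by linarith)]
    linarith
  rw [hr'] at h2
  have h5 : 2 * |θ| / Real.pi = 2 * (|θ| / Real.pi) := by ring
  linarith

/-! ### Growth of Bloch functions -/

/-- The Bloch functions `f` with `|f(0)| ≤ M` and `(1 - |z|²) |f'(z)| ≤ M`. -/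
def blochBall (M : ℝ) : Set Hol :=
  {f | ‖f 0‖ ≤ M ∧ ∀ z ∈ disk, (1 - ‖z‖ ^ 2) * ‖deriv f z‖ ≤ M}

lemma blochBall_nonneg {M : ℝ} {f : Hol} (hf : f ∈ blochBall M) : 0 ≤ M :=
  (norm_nonneg _).trans hf.1

lemma norm_deriv_le_of_mem_blochBall {M : ℝ} {f : Hol} (hf : f ∈ blochBall M) {z : ℂ}
    (hz : z ∈ disk) : ‖deriv f z‖ ≤ M / (1 - ‖z‖) := by
  have h1 := mem_disk.1 hz
  rw [le_div_iff₀ (by linarith)]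
  have h2 := hf.2 z hz
  nlinarith [norm_nonneg (deriv f z), norm_nonneg z,
    mul_nonneg (mul_nonneg (norm_nonneg (deriv f z)) (norm_nonneg z)) (sub_nonneg.2 h1.le)]

lemma norm_le_of_mem_blochBall {M : ℝ} {f : Hol} (hf : f ∈ blochBall M) {z : ℂ}
    (hz : z ∈ disk) : ‖f z‖ ≤ M * (1 - Real.log (1 - ‖z‖)) := by
  have h1 := mem_disk.1 hz
  have hpos : ∀ s : ℝ, s ∈ Set.Icc (0 : ℝ) 1 → 0 < 1 - s * ‖z‖ := fun s hs => by
    nlinarith [hs.1, hs.2, norm_nonneg z]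
  have hmem : ∀ s : ℝ, s ∈ Set.Icc (0 : ℝ) 1 → (s : ℂ) * z ∈ disk := fun s hs => by
    rw [mem_disk, norm_mul, Complex.norm_real, Real.norm_eq_abs, abs_of_nonneg hs.1]
    linarith [hpos s hs]
  have hd : ∀ s : ℝ, s ∈ Set.Icc (0 : ℝ) 1 →
      HasDerivAt (fun s : ℝ => f ((s : ℂ) * z)) (deriv f (s * z) * z) s := fun s hs => by
    have h2 : HasDerivAt (fun w : ℂ => f (w * z)) (deriv f (s * z) * z) (s : ℂ) := by
      have h3 : HasDerivAt (fun w : ℂ => w * z) z (s : ℂ) := by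
        simpa using (hasDerivAt_id (s : ℂ)).mul_const z
      exact (Hol.differentiableAt f (hmem s hs)).hasDerivAt.comp (s : ℂ) h3
    exact h2.comp_ofReal
  have hB : ∀ s : ℝ, s ∈ Set.Icc (0 : ℝ) 1 →
      HasDerivAt (fun s : ℝ => M * (1 - Real.log (1 - s * ‖z‖)))
        (M * (‖z‖ / (1 - s * ‖z‖))) s := fun s hs => by
    have h3 : HasDerivAt (fun s : ℝ => 1 - s * ‖z‖) (-‖z‖) s := by
      simpa using ((hasDerivAt_id s).mul_const ‖z‖).const_sub 1
    refine (((h3.log (hpos s hs).ne').const_sub 1).const_mul M).congr_deriv ?_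
    ring
  -- Along the radius to `z`, the function `M (1 - log (1 - s|z|))` starts at `M ≥ |f(0)|` and its
  -- derivative dominates the speed of `s ↦ f(sz)`.
  have key := image_norm_le_of_norm_deriv_right_le_deriv_boundary' (a := (0 : ℝ)) (b := 1)
    (f := fun s : ℝ => f ((s : ℂ) * z)) (f' := fun s : ℝ => deriv f (s * z) * z)
    (B := fun s : ℝ => M * (1 - Real.log (1 - s * ‖z‖)))
    (B' := fun s : ℝ => M * (‖z‖ / (1 - s * ‖z‖)))
    (fun s hs => (hd s hs).continuousAt.continuousWithinAt)
    (fun s hs => (hd s (Set.Ico_subset_Icc_self hs)).hasDerivWithinAt)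
    (by simpa using hf.1)
    (fun s hs => (hB s hs).continuousAt.continuousWithinAt)
    (fun s hs => (hB s (Set.Ico_subset_Icc_self hs)).hasDerivWithinAt)
    (fun s hs => by
      have hs' := Set.Ico_subset_Icc_self hs
      rw [norm_mul]
      have h4 := norm_deriv_le_of_mem_blochBall hf (hmem s hs')
      rw [norm_mul, Complex.norm_real, Real.norm_eq_abs, abs_of_nonneg hs.1] at h4
      calc _ ≤ M / (1 - s * ‖z‖) * ‖z‖ := by gcongr
        _ = _ := by ring)
    (Set.right_mem_Icc.2 zero_le_one)
  simpa using key

lemma one_sub_log_nonneg {x : ℝ} (h0 : 0 ≤ x) (h1 : x ≤ 1) : 1 ≤ 1 - Real.log x := by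
  linarith [Real.log_nonpos h0 h1]

/-! ### Derivatives of `f(z) (1 - z)^(-α)` -/

/-- The function `f(z) (1 - z)^(-α)`. -/
def lift (α : ℝ) (f : Hol) (z : ℂ) : ℂ := f z * powKernel α z

lemma differentiableOn_lift (α : ℝ) (f : Hol) : DifferentiableOn ℂ (lift α f) disk :=
  f.2.1.mul (differentiableOn_powKernel α)

/-- A point of the closed negative axis is at distance at least `|ζ|` from a `ζ` in the right
half-plane. So `(1 - w)^(-α)` is holomorphic on the whole disk about `z` of radius `|1 - z|`, even
where that disk leaves the unit disk. -/
lemma mem_slitPlane_of_dist_lt {ζ w : ℂ} (hζ : 0 < ζ.re) (h : ‖w - ζ‖ < ‖ζ‖) :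
    w ∈ Complex.slitPlane := by
  rw [Complex.mem_slitPlane_iff]
  by_contra hc
  push Not at hc
  have h2 : ‖w - ζ‖ ^ 2 < ‖ζ‖ ^ 2 := by gcongr
  rw [Complex.sq_norm, Complex.sq_norm, Complex.normSq_apply, Complex.normSq_apply] at h2
  simp only [Complex.sub_re, Complex.sub_im, hc.2] at h2
  nlinarith [hc.1]

lemma norm_powKernel_le {α : ℝ} (hα : 0 < α) {z w : ℂ} (hz : z ∈ disk)
    (h : ‖w - z‖ ≤ ‖1 - z‖ / 2) : ‖powKernel α w‖ ≤ 2 ^ α * ‖1 - z‖ ^ (-α) := by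
  have hz0 : 0 < ‖1 - z‖ := by linarith [one_sub_norm_le z, mem_disk.1 hz]
  have h1 : ‖1 - z‖ / 2 ≤ ‖1 - w‖ := by
    have : ‖1 - z‖ ≤ ‖1 - w‖ + ‖w - z‖ := by
      refine (norm_add_le _ _).trans_eq' ?_
      ring_nf
    linarith
  rw [norm_powKernel]
  calc _ ≤ (‖1 - z‖ / 2) ^ (-α) :=
        Real.rpow_le_rpow_of_nonpos (by positivity) h1 (by linarith)
    _ = _ := by
      rw [Real.div_rpow hz0.le (by norm_num), Real.rpow_neg (by norm_num : (0:ℝ) ≤ 2)]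
      field_simp

/-- Cauchy's estimate at radius `|1 - z|/2`, not at the smaller `(1 - |z|)/2`: each derivative costs
only `|1 - z|^(-1)`. -/
lemma norm_iteratedDeriv_powKernel_le {α : ℝ} (hα : 0 < α) (j : ℕ) {z : ℂ} (hz : z ∈ disk) :
    ‖iteratedDeriv j (powKernel α) z‖ ≤ j.factorial * 2 ^ j * 2 ^ α * ‖1 - z‖ ^ (-α - j) := by
  have hz0 : 0 < ‖1 - z‖ := by linarith [one_sub_norm_le z, mem_disk.1 hz]
  have hd : DiffContOnCl ℂ (powKernel α) (Metric.ball z (‖1 - z‖ / 2)) := by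
    refine DifferentiableOn.diffContOnCl_ball (U := Metric.ball z ‖1 - z‖) (fun w hw => ?_)
      (Metric.closedBall_subset_ball (by linarith))
    refine (hasDerivAt_powKernel α (mem_slitPlane_of_dist_lt (ζ := 1 - z) ?_ ?_)
      ).differentiableAt.differentiableWithinAt
    · have h1 := Complex.re_le_norm z
      have h2 := mem_disk.1 hz
      simp only [Complex.sub_re, Complex.one_re]
      linarith
    · rw [mem_ball_iff_norm] at hw
      rw [sub_sub_sub_cancel_left, norm_sub_rev]
      exact hw
  refine (Complex.norm_iteratedDeriv_le_of_forall_mem_sphere_norm_le j (by positivity) hd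
    (C := 2 ^ α * ‖1 - z‖ ^ (-α)) fun w hw => ?_).trans_eq ?_
  · exact norm_powKernel_le hα hz (mem_sphere_iff_norm.1 hw).le
  · rw [Real.rpow_sub hz0, Real.rpow_natCast, div_pow]
    field_simp

/-- Split `f` as `(f - f(z)) + f(z)`. On the disk of radius `(1 - |z|)/2` the first part is bounded
by `M` with no logarithm, so Cauchy's estimate gives the first term. The second part is a constant
of logarithmic size times the kernel, which may be differentiated at the scale `|1 - z|`. Keeping
the logarithm off the first term is essential when `αp = 1`, where integrating that term over the
angle already produces one. -/
lemma norm_iteratedDeriv_lift_le {α : ℝ} (hα : 0 < α) (j : ℕ) {M : ℝ} {f : Hol}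
    (hf : f ∈ blochBall M) {z : ℂ} (hz : z ∈ disk) :
    ‖iteratedDeriv j (lift α f) z‖ ≤ j.factorial * 2 ^ j * 2 ^ α * M *
      (((1 - ‖z‖) ^ j)⁻¹ * ‖1 - z‖ ^ (-α) +
        (1 - Real.log (1 - ‖z‖)) * ‖1 - z‖ ^ (-α - j)) := by
  have hz1 := mem_disk.1 hz
  set ρ := 1 - ‖z‖ with hρ
  have hρ0 : 0 < ρ := by linarith
  have hM := blochBall_nonneg hf
  have hsub : Metric.closedBall z (ρ / 2) ⊆ disk := fun w hw => by
    rw [mem_closedBall_iff_norm] at hw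
    rw [mem_disk]
    linarith [norm_le_norm_add_norm_sub' w z]
  have hdf : ∀ w ∈ Metric.closedBall z (ρ / 2), ‖f w - f z‖ ≤ M := fun w hw => by
    have h := (convex_closedBall z (ρ / 2)).norm_image_sub_le_of_norm_deriv_le (f := f)
      (C := M / (ρ / 2)) (fun u hu => Hol.differentiableAt f (hsub hu)) (fun u hu => ?_)
      (Metric.mem_closedBall_self (by positivity)) hw
    · refine h.trans ?_
      rw [mem_closedBall_iff_norm] at hw
      calc _ ≤ M / (ρ / 2) * (ρ / 2) := by gcongr
        _ = M := by field_simp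
    · refine (norm_deriv_le_of_mem_blochBall hf (hsub hu)).trans ?_
      rw [mem_closedBall_iff_norm] at hu
      have : ρ / 2 ≤ 1 - ‖u‖ := by linarith [norm_le_norm_add_norm_sub' u z]
      gcongr
  set H : ℂ → ℂ := fun w => (f w - f z) * powKernel α w with hH
  have hHd : DifferentiableOn ℂ H disk :=
    (f.2.1.sub (differentiableOn_const _)).mul (differentiableOn_powKernel α)
  have h1 : ‖iteratedDeriv j H z‖ ≤
      j.factorial * (M * (2 ^ α * ‖1 - z‖ ^ (-α))) / (ρ / 2) ^ j := by
    refine Complex.norm_iteratedDeriv_le_of_forall_mem_sphere_norm_le j (by positivity)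
      (hHd.diffContOnCl_ball hsub) fun w hw => ?_
    rw [hH, norm_mul]
    have hb := norm_powKernel_le (w := w) hα hz
      (by rw [mem_sphere_iff_norm.1 hw]; linarith [one_sub_norm_le z])
    gcongr
    exact hdf w (Metric.sphere_subset_closedBall hw)
  have h2 := norm_iteratedDeriv_powKernel_le hα j hz
  have h3 := norm_le_of_mem_blochBall hf hz
  have hsplit : lift α f = H + fun w => f z * powKernel α w := by
    funext w
    simp only [lift, hH, Pi.add_apply]
    ring
  have hcd : ∀ g : ℂ → ℂ, DifferentiableOn ℂ g disk → ContDiffAt ℂ j g z := fun g hg =>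
    (hg.contDiffOn Metric.isOpen_ball).contDiffAt (disk_mem_nhds hz)
  rw [hsplit, iteratedDeriv_add (hcd _ hHd)
    (hcd (fun w => f z * powKernel α w)
      ((differentiableOn_const _).mul (differentiableOn_powKernel α))),
    iteratedDeriv_const_mul_field]
  refine (norm_add_le _ _).trans ?_
  rw [norm_mul, mul_add]
  refine add_le_add (h1.trans_eq ?_) ?_
  · rw [div_pow]
    field_simp
  · calc _ ≤ M * (1 - Real.log ρ) * (j.factorial * 2 ^ j * 2 ^ α * ‖1 - z‖ ^ (-α - j)) := by
          gcongr
          exact (norm_nonneg _).trans h3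
      _ = _ := by ring

/-! ### The integral representation of the Cesàro-like operator -/

lemma norm_coe_mul_le (t : Set.Ico (0 : ℝ) 1) (z : ℂ) : ‖((t : ℝ) : ℂ) * z‖ ≤ ‖z‖ := by
  rw [norm_mul, Complex.norm_real, Real.norm_eq_abs, abs_of_nonneg t.2.1]
  exact mul_le_of_le_one_left (norm_nonneg _) t.2.2.le

lemma coe_mul_mem_disk (t : Set.Ico (0 : ℝ) 1) {z : ℂ} (hz : z ∈ disk) :
    ((t : ℝ) : ℂ) * z ∈ disk :=
  mem_disk.2 ((norm_coe_mul_le t z).trans_lt (mem_disk.1 hz))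

lemma norm_coe_pow_le_one (t : Set.Ico (0 : ℝ) 1) (j : ℕ) : ‖((t : ℝ) : ℂ) ^ j‖ ≤ 1 := by
  rw [norm_pow, Complex.norm_real, Real.norm_eq_abs, abs_of_nonneg t.2.1]
  exact pow_le_one₀ t.2.1 t.2.2.le

lemma exists_norm_le_of_continuousOn {G : ℂ → ℂ} (hG : ContinuousOn G disk) {ρ : ℝ} (hρ : ρ < 1) :
    ∃ C, ∀ w, ‖w‖ ≤ ρ → ‖G w‖ ≤ C := by
  obtain ⟨C, hC⟩ := (isCompact_closedBall (0 : ℂ) ρ).exists_bound_of_continuousOn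
    (hG.mono (Metric.closedBall_subset_ball hρ))
  exact ⟨C, fun w hw => hC w (mem_closedBall_zero_iff.2 hw)⟩

lemma continuous_coe_mul {G : ℂ → ℂ} (hG : ContinuousOn G disk) {z : ℂ} (hz : z ∈ disk) :
    Continuous fun t : Set.Ico (0 : ℝ) 1 => G (((t : ℝ) : ℂ) * z) :=
  hG.comp_continuous (by fun_prop) fun t => coe_mul_mem_disk t hz

/-- The integral `∫ f(tz) (1 - tz)^(-α) dμ(t)`. -/
def cesaroIntegral (μ : Measure (Set.Ico (0 : ℝ) 1)) (α : ℝ) (f : Hol) (z : ℂ) : ℂ :=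
  ∫ t : Set.Ico (0 : ℝ) 1, lift α f (((t : ℝ) : ℂ) * z) ∂μ

section

variable (μ : Measure (Set.Ico (0 : ℝ) 1)) [IsFiniteMeasure μ]

lemma integrable_dilation (j : ℕ) {G : ℂ → ℂ} (hG : ContinuousOn G disk) {z : ℂ} (hz : z ∈ disk) :
    Integrable (fun t : Set.Ico (0 : ℝ) 1 => ((t : ℝ) : ℂ) ^ j * G (((t : ℝ) : ℂ) * z)) μ := by
  obtain ⟨C, hC⟩ := exists_norm_le_of_continuousOn hG (mem_disk.1 hz)
  refine Integrable.of_bound (C := 1 * C) ?_ (ae_of_all _ fun t => ?_)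
  · have := continuous_coe_mul hG hz
    exact (Continuous.mul (by fun_prop) this).aestronglyMeasurable
  · rw [norm_mul]
    gcongr
    · exact norm_coe_pow_le_one t j
    · exact hC _ (norm_coe_mul_le t z)

lemma hasDerivAt_integral_dilation (j : ℕ) {G : ℂ → ℂ} (hG : DifferentiableOn ℂ G disk) {z : ℂ}
    (hz : z ∈ disk) :
    HasDerivAt (fun z => ∫ t : Set.Ico (0 : ℝ) 1, ((t : ℝ) : ℂ) ^ j * G (((t : ℝ) : ℂ) * z) ∂μ)
      (∫ t : Set.Ico (0 : ℝ) 1, ((t : ℝ) : ℂ) ^ (j + 1) * deriv G (((t : ℝ) : ℂ) * z) ∂μ) z := by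
  have hG' := hG.deriv Metric.isOpen_ball
  obtain ⟨ρ, hzρ, hρ⟩ := exists_between (mem_disk.1 hz)
  obtain ⟨C, hC⟩ := exists_norm_le_of_continuousOn hG'.continuousOn hρ
  have hsub : ∀ w ∈ Metric.ball (0 : ℂ) ρ, w ∈ disk := fun w hw =>
    Metric.ball_subset_ball hρ.le hw
  refine (hasDerivAt_integral_of_dominated_loc_of_deriv_le (s := Metric.ball 0 ρ)
    (bound := fun _ => 1 * C)
    (F' := fun w (t : Set.Ico (0 : ℝ) 1) => ((t : ℝ) : ℂ) ^ (j + 1) * deriv G (((t : ℝ) : ℂ) * w))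
    (Metric.isOpen_ball.mem_nhds (mem_ball_zero_iff.2 hzρ)) ?_
    (integrable_dilation μ j hG.continuousOn hz)
    (integrable_dilation μ (j + 1) hG'.continuousOn hz).aestronglyMeasurable
    (ae_of_all _ fun t w hw => ?_) (integrable_const _) (ae_of_all _ fun t w hw => ?_)).2
  · filter_upwards [disk_mem_nhds hz] with w hw
    exact (integrable_dilation μ j hG.continuousOn hw).aestronglyMeasurable
  · rw [norm_mul]
    gcongr
    · exact norm_coe_pow_le_one t _
    · exact hC _ ((norm_coe_mul_le t w).trans (mem_ball_zero_iff.1 hw).le)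
  · have h1 : HasDerivAt (fun w : ℂ => ((t : ℝ) : ℂ) * w) ((t : ℝ) : ℂ) w := by
      simpa using (hasDerivAt_id w).const_mul ((t : ℝ) : ℂ)
    have h2 := (hG.differentiableAt (disk_mem_nhds
      (coe_mul_mem_disk t (hsub w hw)))).hasDerivAt.comp w h1
    refine (h2.const_mul (((t : ℝ) : ℂ) ^ j)).congr_deriv ?_
    ring

lemma differentiableOn_iteratedDeriv {G : ℂ → ℂ} (hG : DifferentiableOn ℂ G disk) (j : ℕ) :
    DifferentiableOn ℂ (iteratedDeriv j G) disk := by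
  induction j with
  | zero => simpa using hG
  | succ j ih =>
    rw [iteratedDeriv_succ]
    exact ih.deriv Metric.isOpen_ball

lemma iteratedDeriv_integral_dilation (j : ℕ) {G : ℂ → ℂ} (hG : DifferentiableOn ℂ G disk) :
    ∀ z ∈ disk, iteratedDeriv j (fun z => ∫ t : Set.Ico (0 : ℝ) 1, G (((t : ℝ) : ℂ) * z) ∂μ) z =
      ∫ t : Set.Ico (0 : ℝ) 1, ((t : ℝ) : ℂ) ^ j * iteratedDeriv j G (((t : ℝ) : ℂ) * z) ∂μ := by
  induction j with
  | zero => intro z _; simp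
  | succ j ih =>
    intro z hz
    rw [iteratedDeriv_succ, Filter.EventuallyEq.deriv_eq (Filter.eventuallyEq_of_mem
      (disk_mem_nhds hz) ih), (hasDerivAt_integral_dilation μ j
      (differentiableOn_iteratedDeriv hG j) hz).deriv, iteratedDeriv_succ]

lemma iteratedDeriv_cesaroIntegral (α : ℝ) (f : Hol) (j : ℕ) {z : ℂ} (hz : z ∈ disk) :
    iteratedDeriv j (cesaroIntegral μ α f) z = ∫ t : Set.Ico (0 : ℝ) 1,
      ((t : ℝ) : ℂ) ^ j * iteratedDeriv j (lift α f) (((t : ℝ) : ℂ) * z) ∂μ :=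
  iteratedDeriv_integral_dilation μ j (differentiableOn_lift α f) z hz

lemma differentiableOn_cesaroIntegral (α : ℝ) (f : Hol) :
    DifferentiableOn ℂ (cesaroIntegral μ α f) disk := fun z hz => by
  have h := hasDerivAt_integral_dilation μ 0 (differentiableOn_lift α f) hz
  simp only [pow_zero, one_mul] at h
  exact h.differentiableAt.differentiableWithinAt

lemma hasSum_taylorCoeff (f : Hol) {z : ℂ} (hz : z ∈ disk) :
    HasSum (fun n => taylorCoeff f n * z ^ n) (f z) := by
  have h := Complex.hasSum_taylorSeries_on_ball f.2.1 hz
  refine h.congr_fun fun n => ?_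
  simp only [taylorCoeff, sub_zero, smul_eq_mul]
  ring

lemma hasSum_powKernel {α : ℝ} (hα : 0 < α) {z : ℂ} (hz : z ∈ disk) :
    HasSum (fun n : ℕ =>
      ((Real.Gamma ((n : ℝ) + α) / (Real.Gamma α * (n.factorial : ℝ)) : ℝ) : ℂ) * z ^ n)
      (powKernel α z) := by
  have h := Complex.hasSum_taylorSeries_on_ball (differentiableOn_powKernel α) hz
  refine h.congr_fun fun n => ?_
  have h1 : powKernel (α + n) 0 = 1 := by simp [powKernel]
  rw [iteratedDeriv_powKernel hα n 0 zero_mem_disk, h1]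
  simp only [sub_zero, smul_eq_mul]
  push_cast
  field_simp

/-- The `n`-th Taylor coefficient of `f(z) (1 - z)^(-α)`. -/
def liftCoeff (α : ℝ) (f : Hol) (n : ℕ) : ℂ := ∑ k ∈ Finset.range (n + 1),
  ((Real.Gamma (((n - k : ℕ) : ℝ) + α) / (Real.Gamma α * ((n - k).factorial : ℝ)) : ℝ) : ℂ) *
    taylorCoeff f k

lemma hasSum_liftCoeff {α : ℝ} (hα : 0 < α) (f : Hol) {z : ℂ} (hz : z ∈ disk) :
    HasSum (fun n => liftCoeff α f n * z ^ n) (lift α f z) := by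
  have h1 := hasSum_taylorCoeff f hz
  have h2 := hasSum_powKernel hα hz
  have h3 := (summable_norm_sum_mul_range_of_summable_norm h1.summable.norm
    h2.summable.norm).of_norm.hasSum
  rw [← tsum_mul_tsum_eq_tsum_sum_range_of_summable_norm h1.summable.norm h2.summable.norm,
    h1.tsum_eq, h2.tsum_eq] at h3
  refine h3.congr_fun fun n => ?_
  rw [liftCoeff, Finset.sum_mul]
  refine Finset.sum_congr rfl fun k hk => ?_
  have hk' : k ≤ n := Nat.lt_succ_iff.1 (Finset.mem_range.1 hk)
  rw [← pow_mul_pow_sub z hk']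
  ring

/-- The series of `f(w) (1 - w)^(-α)` at `w = tz` is dominated, uniformly in `t`, by the absolutely
convergent series at `z`; integrating it term by term produces the moments. -/
lemma cesaro_eq_cesaroIntegral {α : ℝ} (hα : 0 < α) (f : Hol) {z : ℂ} (hz : z ∈ disk) :
    cesaro μ α f z = cesaroIntegral μ α f z := by
  have hs := (hasSum_liftCoeff hα f hz).summable.norm
  have hterm : ∀ (n : ℕ) (t : Set.Ico (0 : ℝ) 1),
      liftCoeff α f n * (((t : ℝ) : ℂ) * z) ^ n = liftCoeff α f n * z ^ n * ((t ^ n : ℝ) : ℂ) :=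
    fun n t => by push_cast; ring
  have hint : ∀ n : ℕ, Integrable (fun t : Set.Ico (0 : ℝ) 1 =>
      liftCoeff α f n * (((t : ℝ) : ℂ) * z) ^ n) μ := fun n => by
    have := integrable_dilation μ 0 (G := fun w => liftCoeff α f n * w ^ n)
      (by fun_prop) hz
    simpa using this
  have hnorm : ∀ (n : ℕ) (t : Set.Ico (0 : ℝ) 1),
      ‖liftCoeff α f n * (((t : ℝ) : ℂ) * z) ^ n‖ ≤ ‖liftCoeff α f n * z ^ n‖ := fun n t => by
    rw [norm_mul, norm_mul, norm_pow, norm_pow]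
    gcongr
    exact norm_coe_mul_le t z
  have h := hasSum_integral_of_summable_integral_norm hint (by
    refine Summable.of_nonneg_of_le (fun n => integral_nonneg fun t => norm_nonneg _)
      (fun n => ?_) (hs.mul_left (μ.real Set.univ))
    calc _ ≤ ∫ t : Set.Ico (0 : ℝ) 1, ‖liftCoeff α f n * z ^ n‖ ∂μ :=
          integral_mono (hint n).norm (integrable_const _) (hnorm n)
      _ = _ := by simp)
  have h2 : ∫ t : Set.Ico (0 : ℝ) 1, ∑' n, liftCoeff α f n * (((t : ℝ) : ℂ) * z) ^ n ∂μ =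
      cesaroIntegral μ α f z :=
    integral_congr_ae (ae_of_all _ fun t => (hasSum_liftCoeff hα f (coe_mul_mem_disk t hz)).tsum_eq)
  rw [h2] at h
  rw [← h.tsum_eq, cesaro]
  refine tsum_congr fun n => ?_
  simp_rw [hterm]
  rw [integral_const_mul, integral_complex_ofReal, moment, liftCoeff]
  ring

end

/-! ### Pointwise domination by dyadic blocks -/

/-- The bound for `|(f(z) (1 - z)^(-α))^(j)|` at the points with argument `θ` and distance at
least `2^(-k-1)` to the unit circle, for `f` in the unit ball of the Bloch space. -/
def blockKernel (α : ℝ) (j k : ℕ) (θ : ℝ) : ℝ :=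
  2 ^ (j * k) * max ((1 / 2) ^ k) |θ| ^ (-α) + (k + 1) * max ((1 / 2) ^ k) |θ| ^ (-α - j)

lemma max_block_pos (k : ℕ) (θ : ℝ) : 0 < max ((1 / 2 : ℝ) ^ k) |θ| :=
  lt_max_of_lt_left (by positivity)

lemma blockKernel_nonneg (α : ℝ) (j k : ℕ) (θ : ℝ) : 0 ≤ blockKernel α j k θ := by
  have := max_block_pos k θ
  unfold blockKernel
  positivity

/-- The points of `[0, 1)` at distance at most `2^(-k)` to `1`. -/
def tailSet (k : ℕ) : Set (Set.Ico (0 : ℝ) 1) := {t | 1 - (1 / 2) ^ k ≤ (t : ℝ)}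

lemma measurableSet_tailSet (k : ℕ) : MeasurableSet (tailSet k) :=
  measurableSet_le measurable_const measurable_subtype_coe

lemma abs_div_le_norm_one_sub_of_arg {z : ℂ} (hz : ‖z‖ ≤ 1) : |z.arg| / 4 ≤ ‖1 - z‖ := by
  have h := abs_div_pi_le_norm_one_sub (norm_nonneg z) hz (Complex.abs_arg_le_pi z)
  rw [mul_comm Complex.I, Complex.norm_mul_exp_arg_mul_I] at h
  refine le_trans ?_ h
  exact div_le_div_of_nonneg_left (abs_nonneg _) Real.pi_pos Real.pi_lt_four.le

/-- Both `1 - |w|` and `|θ|` bound `|1 - w|` from below, so `|1 - w|` is at least a quarter of `max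
(2^(-k), |θ|)`. The angle `θ` need not be `arg w`, which leaves room for `w = 0`. -/
lemma kernel_le_blockKernel {α : ℝ} (hα : 0 < α) (j k : ℕ) {w : ℂ} {θ : ℝ}
    (hw : (1 / 2) ^ (k + 1) ≤ 1 - ‖w‖) (hθ : |θ| / 4 ≤ ‖1 - w‖) :
    ((1 - ‖w‖) ^ j)⁻¹ * ‖1 - w‖ ^ (-α) + (1 - Real.log (1 - ‖w‖)) * ‖1 - w‖ ^ (-α - j) ≤
      2 ^ (j + 1) * 4 ^ (α + j) * blockKernel α j k θ := by
  set D := max ((1 / 2 : ℝ) ^ k) |θ| with hD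
  have hD0 : 0 < D := max_block_pos k θ
  have hpow : (1 / 2 : ℝ) ^ (k + 1) = (1 / 2) ^ k / 2 := by rw [pow_succ]; ring
  have hk0 : (0 : ℝ) < (1 / 2) ^ k := by positivity
  have h1 : D / 4 ≤ ‖1 - w‖ := by
    rw [div_le_iff₀ (by norm_num)]
    refine max_le ?_ (by linarith)
    linarith [one_sub_norm_le w]
  have hx0 : 0 < 1 - ‖w‖ := lt_of_lt_of_le (by positivity) hw
  have hpw : ∀ c : ℝ, 0 ≤ c → c ≤ α + j → ‖1 - w‖ ^ (-c) ≤ 4 ^ (α + j) * D ^ (-c) := fun c hc hc' => by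
    calc _ ≤ (D / 4) ^ (-c) := Real.rpow_le_rpow_of_nonpos (by positivity) h1 (by linarith)
      _ = 4 ^ c * D ^ (-c) := by
        rw [Real.div_rpow hD0.le (by norm_num), Real.rpow_neg (by norm_num : (0 : ℝ) ≤ 4)]
        field_simp
      _ ≤ _ := by
        gcongr
        norm_num
  have hj : ((1 - ‖w‖) ^ j)⁻¹ ≤ 2 ^ j * 2 ^ (j * k) := by
    calc _ ≤ (((1 / 2 : ℝ) ^ (k + 1)) ^ j)⁻¹ := by gcongr
      _ = _ := by
        rw [← pow_mul, one_div, inv_pow, inv_inv, ← pow_add]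
        congr 1
        ring
  have hlog : 1 - Real.log (1 - ‖w‖) ≤ 2 * (k + 1) := by
    have h2 := Real.log_le_log (by positivity) hw
    rw [Real.log_pow, one_div, Real.log_inv] at h2
    push_cast at h2
    nlinarith [Real.log_two_lt_d9, Real.log_two_gt_d9, (Nat.cast_nonneg k : (0 : ℝ) ≤ k)]
  have h2j : (1 : ℝ) ≤ 2 ^ j := one_le_pow₀ (by norm_num)
  have e1 := hpw α hα.le (by linarith [(Nat.cast_nonneg j : (0 : ℝ) ≤ j)])
  have e2 := hpw (α + j) (by positivity) le_rfl
  rw [neg_add'] at e2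
  have hl0 : 0 ≤ 1 - Real.log (1 - ‖w‖) :=
    zero_le_one.trans (one_sub_log_nonneg hx0.le (by linarith [norm_nonneg w]))
  have hX : 0 ≤ 4 ^ (α + j) * (2 ^ (j * k) * D ^ (-α)) := by positivity
  have hY : 0 ≤ 4 ^ (α + j) * ((k + 1) * D ^ (-α - j)) := by positivity
  calc _ ≤ 2 ^ j * 2 ^ (j * k) * (4 ^ (α + j) * D ^ (-α)) +
        2 * (k + 1) * (4 ^ (α + j) * D ^ (-α - j)) := by gcongr
    _ = 2 ^ j * (4 ^ (α + j) * (2 ^ (j * k) * D ^ (-α))) +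
        2 * (4 ^ (α + j) * ((k + 1) * D ^ (-α - j))) := by ring
    _ ≤ 2 ^ (j + 1) * (4 ^ (α + j) * (2 ^ (j * k) * D ^ (-α))) +
        2 ^ (j + 1) * (4 ^ (α + j) * ((k + 1) * D ^ (-α - j))) := by
      rw [pow_succ]
      gcongr <;> nlinarith
    _ = _ := by rw [blockKernel]; ring

/-- Take the largest `k ≤ m` with `t` in the `k`-th tail. If `k = m`, use `1 - tx ≥ 1 - x`;
otherwise `t` misses the next tail and `1 - tx ≥ 1 - t > 2^(-k-1)`. -/
lemma exists_mem_tailSet (t : Set.Ico (0 : ℝ) 1) {x : ℝ} (hx0 : 0 ≤ x) {m : ℕ}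
    (hx : (1 / 2) ^ (m + 1) ≤ 1 - x) :
    ∃ k ∈ Finset.range (m + 1), t ∈ tailSet k ∧ (1 / 2) ^ (k + 1) ≤ 1 - t * x := by
  classical
  have h0 : t ∈ tailSet 0 := by simpa [tailSet] using t.2.1
  set k := Nat.findGreatest (fun k => t ∈ tailSet k) m with hk
  have hkm : k ≤ m := Nat.findGreatest_le m
  refine ⟨k, Finset.mem_range.2 (Nat.lt_succ_of_le hkm),
    Nat.findGreatest_spec (P := fun k => t ∈ tailSet k) (Nat.zero_le m) h0, ?_⟩
  have hx1 : x ≤ 1 := by linarith [pow_pos (by norm_num : (0 : ℝ) < 1 / 2) (m + 1)]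
  rcases hkm.eq_or_lt with h | h
  · rw [h]
    nlinarith [t.2.1, t.2.2]
  · have h2 : t ∉ tailSet (k + 1) :=
      Nat.findGreatest_is_greatest (P := fun k => t ∈ tailSet k) (Nat.lt_succ_self k) h
    simp only [tailSet, Set.mem_ofPred_eq, not_le] at h2
    nlinarith [t.2.1, t.2.2]

section

variable (μ : Measure (Set.Ico (0 : ℝ) 1)) [IsFiniteMeasure μ]

lemma exists_norm_iteratedDeriv_cesaroIntegral_le {α : ℝ} (hα : 0 < α) (j : ℕ) :
    ∃ C : ℝ, 0 ≤ C ∧ ∀ (M : ℝ) (f : Hol), f ∈ blochBall M → ∀ (z : ℂ) (m : ℕ),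
      (1 / 2) ^ (m + 1) ≤ 1 - ‖z‖ → ‖iteratedDeriv j (cesaroIntegral μ α f) z‖ ≤
        C * M * ∑ k ∈ Finset.range (m + 1), μ.real (tailSet k) * blockKernel α j k z.arg := by
  refine ⟨j.factorial * 2 ^ j * 2 ^ α * (2 ^ (j + 1) * 4 ^ (α + j)), by positivity,
    fun M f hf z m hz => ?_⟩
  have hM := blochBall_nonneg hf
  have hzd : z ∈ disk := by
    rw [mem_disk]
    linarith [pow_pos (by norm_num : (0 : ℝ) < 1 / 2) (m + 1)]
  set A : ℝ := j.factorial * 2 ^ j * 2 ^ α with hA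
  set B : ℝ := 2 ^ (j + 1) * 4 ^ (α + j) with hB
  have hint : ∀ k ∈ Finset.range (m + 1), Integrable
      ((tailSet k).indicator fun _ => blockKernel α j k z.arg) μ := fun k _ =>
    (integrable_const _).indicator (measurableSet_tailSet k)
  rw [iteratedDeriv_cesaroIntegral μ α f j hzd]
  have hval : ∫ t, A * B * M * ∑ k ∈ Finset.range (m + 1),
      (tailSet k).indicator (fun _ => blockKernel α j k z.arg) t ∂μ =
      A * B * M * ∑ k ∈ Finset.range (m + 1), μ.real (tailSet k) * blockKernel α j k z.arg := by
    rw [integral_const_mul, integral_finsetSum _ hint]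
    congr 1
    refine Finset.sum_congr rfl fun k _ => ?_
    rw [integral_indicator_const _ (measurableSet_tailSet k), smul_eq_mul]
  rw [← hval]
  refine norm_integral_le_of_norm_le ((integrable_finsetSum _ hint).const_mul _)
    (ae_of_all _ fun t => ?_)
  obtain ⟨k, hkm, hkt, hk⟩ := exists_mem_tailSet t (norm_nonneg z) hz
  set w := ((t : ℝ) : ℂ) * z with hw
  have hwn : ‖w‖ = t * ‖z‖ := by
    rw [hw, norm_mul, Complex.norm_real, Real.norm_eq_abs, abs_of_nonneg t.2.1]
  have hθ : |z.arg| / 4 ≤ ‖1 - w‖ := by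
    -- For `t = 0` the argument of `tz` is no longer that of `z`, but then `|1 - tz| = 1 ≥ π/4`.
    rcases t.2.1.eq_or_lt with h | h
    · rw [hw, ← h]
      simp only [Complex.ofReal_zero, zero_mul, sub_zero, norm_one]
      linarith [Complex.abs_arg_le_pi z, Real.pi_lt_four]
    · have h2 : w.arg = z.arg := Complex.arg_real_mul z h
      rw [← h2]
      exact abs_div_le_norm_one_sub_of_arg (mem_disk.1 (coe_mul_mem_disk t hzd)).le
  have h1 := norm_iteratedDeriv_lift_le hα j hf (coe_mul_mem_disk t hzd)
  have h2 := kernel_le_blockKernel hα j k (hwn ▸ hk) hθ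
  calc _ ≤ 1 * ‖iteratedDeriv j (lift α f) w‖ := by
        rw [norm_mul]
        gcongr
        exact norm_coe_pow_le_one t j
    _ ≤ A * M * (B * blockKernel α j k z.arg) := by
      rw [one_mul]
      refine h1.trans ?_
      gcongr
    _ = A * B * M * (tailSet k).indicator (fun _ => blockKernel α j k z.arg) t := by
      rw [Set.indicator_of_mem hkt]
      ring
    _ ≤ _ := by
      gcongr
      -- One block already dominates the integrand; the other blocks are nonnegative. Summing over
      -- all `k` makes the bound integrable in `t` without choosing `k` measurably.
      exact Finset.single_le_sum (f := fun k =>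
        (tailSet k).indicator (fun _ => blockKernel α j k z.arg) t)
        (fun i _ => Set.indicator_nonneg (fun _ _ => blockKernel_nonneg _ _ _ _) _) hkm

end

/-! ### Integrals of `max(d, |θ|)^(-c)` -/

lemma continuous_max_rpow {d : ℝ} (hd : 0 < d) (c : ℝ) :
    Continuous fun θ : ℝ => max d |θ| ^ c :=
  (continuous_const.max continuous_abs).rpow_const fun _ =>
    Or.inl (lt_max_of_lt_left hd).ne'

lemma intervalIntegral_max_rpow {d : ℝ} (hd : 0 < d) (hd1 : d ≤ 1) (c : ℝ) :
    ∫ θ in (-Real.pi)..Real.pi, max d |θ| ^ (-c) =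
      2 * (d ^ (1 - c) + ∫ θ in d..Real.pi, θ ^ (-c)) := by
  have hpi := Real.pi_gt_three
  have hi : ∀ a b : ℝ, IntervalIntegrable (fun θ : ℝ => max d |θ| ^ (-c)) volume a b :=
    fun a b => (continuous_max_rpow hd _).intervalIntegrable a b
  have h1 : ∫ θ in (-Real.pi)..0, max d |θ| ^ (-c) = ∫ θ in (0 : ℝ)..Real.pi, max d |θ| ^ (-c) := by
    have h := intervalIntegral.integral_comp_neg (a := (0 : ℝ)) (b := Real.pi)
      (fun θ : ℝ => max d |θ| ^ (-c))
    simp only [abs_neg, neg_zero] at h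
    exact h.symm
  have h2 : ∫ θ in (0 : ℝ)..d, max d |θ| ^ (-c) = d ^ (1 - c) := by
    have : ∫ θ in (0 : ℝ)..d, max d |θ| ^ (-c) = ∫ θ in (0 : ℝ)..d, d ^ (-c) :=
      intervalIntegral.integral_congr fun θ hθ => by
        rw [Set.uIcc_of_le hd.le] at hθ
        simp only [abs_of_nonneg hθ.1, max_eq_left hθ.2]
    rw [this, intervalIntegral.integral_const, sub_zero, smul_eq_mul, sub_eq_add_neg,
      Real.rpow_add hd, Real.rpow_one]
  have h3 : ∫ θ in d..Real.pi, max d |θ| ^ (-c) = ∫ θ in d..Real.pi, θ ^ (-c) :=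
    intervalIntegral.integral_congr fun θ hθ => by
      rw [Set.uIcc_of_le (by linarith)] at hθ
      simp only [abs_of_nonneg (hd.le.trans hθ.1), max_eq_right hθ.1]
  rw [← intervalIntegral.integral_add_adjacent_intervals (hi _ 0) (hi _ _), h1,
    ← intervalIntegral.integral_add_adjacent_intervals (hi 0 d) (hi _ _), h2, h3]
  ring

lemma integral_max_rpow_le_of_one_lt {d c : ℝ} (hd : 0 < d) (hd1 : d ≤ 1) (hc : 1 < c) :
    ∫ θ in (-Real.pi)..Real.pi, max d |θ| ^ (-c) ≤ 2 * (1 + 1 / (c - 1)) * d ^ (1 - c) := by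
  have hpi := Real.pi_gt_three
  have hc0 : 0 < c - 1 := by linarith
  rw [intervalIntegral_max_rpow hd hd1, integral_rpow (Or.inr ⟨by linarith, by
    rw [Set.uIcc_of_le (by linarith)]
    exact fun h => absurd h.1 (by linarith)⟩)]
  have h1 : 0 ≤ Real.pi ^ (1 - c) := by positivity
  have h2 : (Real.pi ^ (-c + 1) - d ^ (-c + 1)) / (-c + 1) =
      (d ^ (1 - c) - Real.pi ^ (1 - c)) / (c - 1) := by
    rw [show -c + 1 = 1 - c by ring, ← neg_sub c 1, div_neg, ← neg_div, neg_sub, neg_sub]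
  rw [h2]
  have h3 : (d ^ (1 - c) - Real.pi ^ (1 - c)) / (c - 1) ≤ d ^ (1 - c) / (c - 1) := by
    gcongr
    linarith
  calc _ ≤ 2 * (d ^ (1 - c) + d ^ (1 - c) / (c - 1)) := by gcongr
    _ = _ := by ring

/-- From `θ^(-c) ≤ d^(1-c) / θ` for `θ ≥ d`. Unlike the previous bound, the constant stays finite at
`c = 1`, where the logarithm is genuine. -/
lemma integral_max_rpow_le_of_one_le {d c : ℝ} (hd : 0 < d) (hd1 : d ≤ 1) (hc : 1 ≤ c) :
    ∫ θ in (-Real.pi)..Real.pi, max d |θ| ^ (-c) ≤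
      2 * (1 + Real.log (Real.pi / d)) * d ^ (1 - c) := by
  have hpi := Real.pi_gt_three
  have hne : ∀ θ ∈ Set.uIcc d Real.pi, θ ≠ 0 := fun θ hθ => by
    rw [Set.uIcc_of_le (by linarith)] at hθ
    linarith [hθ.1]
  have h1 : ∫ θ in d..Real.pi, θ ^ (-c) ≤ ∫ θ in d..Real.pi, d ^ (1 - c) * (1 / θ) := by
    refine intervalIntegral.integral_mono_on (by linarith) ?_ ?_ fun θ hθ => ?_
    · exact ContinuousOn.intervalIntegrable fun θ hθ =>
        (Real.continuousAt_rpow_const _ _ (Or.inl (hne θ hθ))).continuousWithinAt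
    · exact ContinuousOn.intervalIntegrable fun θ hθ =>
        (continuousAt_const.mul (continuousAt_const.div continuousAt_id
          (hne θ hθ))).continuousWithinAt
    · have hθ0 : 0 < θ := hd.trans_le hθ.1
      rw [show -c = (1 - c) + (-1) by ring, Real.rpow_add hθ0, Real.rpow_neg_one, one_div]
      gcongr ?_ * _
      exact Real.rpow_le_rpow_of_nonpos hd hθ.1 (by linarith)
  rw [intervalIntegral.integral_const_mul, integral_one_div_of_pos hd Real.pi_pos] at h1
  rw [intervalIntegral_max_rpow hd hd1]
  calc _ ≤ 2 * (d ^ (1 - c) + d ^ (1 - c) * Real.log (Real.pi / d)) := by gcongr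
    _ = _ := by ring

/-! ### Integrals over dyadic annuli -/

lemma continuous_blockKernel (α : ℝ) (j k : ℕ) : Continuous (blockKernel α j k) := by
  have hd : (0 : ℝ) < (1 / 2) ^ k := by positivity
  have h1 := continuous_max_rpow hd (-α)
  have h2 := continuous_max_rpow hd (-α - j)
  unfold blockKernel
  fun_prop

lemma half_pow_rpow (k : ℕ) (x : ℝ) : ((1 / 2 : ℝ) ^ k) ^ x = 2 ^ (-(k * x)) := by
  rw [← Real.rpow_natCast, ← Real.rpow_mul (by norm_num), one_div, Real.inv_rpow (by norm_num),
    Real.rpow_neg (by norm_num)]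

/-- The first summand of the kernel is integrated with exponent `αp ≥ 1`, perhaps equal to 1, and
costs a factor of order `k + 1 ≤ (k+1)^p`. The second has exponent `αp + jp ≥ 2`, so it costs no
further logarithm. -/
lemma integral_blockKernel_rpow_le {α p : ℝ} {j : ℕ} (hp : 1 ≤ p) (hαp : 1 ≤ α * p)
    (hjp : 1 ≤ j * p) (k : ℕ) :
    ∫ θ in (-Real.pi)..Real.pi, blockKernel α j k θ ^ p ≤
      2 ^ p * 10 * ((k + 1) ^ p * 2 ^ (k * (α * p + j * p - 1))) := by
  set d : ℝ := (1 / 2) ^ k with hdef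
  have hd : 0 < d := by positivity
  have hd1 : d ≤ 1 := pow_le_one₀ (by norm_num) (by norm_num)
  have hp0 : 0 < p := by linarith
  have hk1 : (1 : ℝ) ≤ k + 1 := by linarith [(Nat.cast_nonneg k : (0 : ℝ) ≤ k)]
  have h2 : ∀ u v : ℝ, 0 ≤ u → 0 ≤ v → (u + v) ^ p ≤ 2 ^ p * (u ^ p + v ^ p) := fun u v hu hv => by
    have hmax : (max u v) ^ p ≤ u ^ p + v ^ p := by
      rcases max_choice u v with h | h <;> rw [h]
      · linarith [Real.rpow_nonneg hv p]
      · linarith [Real.rpow_nonneg hu p]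
    calc _ ≤ (2 * max u v) ^ p := by
          gcongr
          linarith [le_max_left u v, le_max_right u v]
      _ = 2 ^ p * max u v ^ p := Real.mul_rpow (by norm_num) (le_max_of_le_left hu)
      _ ≤ _ := by gcongr
  have hpt : ∀ θ : ℝ, blockKernel α j k θ ^ p ≤ 2 ^ p * (2 ^ (k * (j * p)) * max d |θ| ^ (-(α * p)) +
      (k + 1) ^ p * max d |θ| ^ (-(α * p + j * p))) := fun θ => by
    have hD : 0 < max d |θ| := max_block_pos k θ
    refine (h2 _ _ (by positivity) (by positivity)).trans_eq ?_
    rw [Real.mul_rpow (by positivity) (by positivity), Real.mul_rpow (by positivity) (by positivity),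
      ← Real.rpow_mul hD.le, ← Real.rpow_mul hD.le, ← Real.rpow_natCast 2,
      ← Real.rpow_mul (by norm_num)]
    congr 4
    · push_cast
      ring
    · ring_nf
    · ring
  have hc1 := continuous_max_rpow hd (-(α * p))
  have hc2 := continuous_max_rpow hd (-(α * p + j * p))
  have hlog : 1 + Real.log (Real.pi / d) ≤ 3 * (k + 1) := by
    rw [Real.log_div Real.pi_ne_zero hd.ne', hdef, Real.log_pow, one_div, Real.log_inv]
    have h4 : Real.log Real.pi ≤ 2 := by
      have h5 := Real.log_le_log Real.pi_pos Real.pi_lt_four.le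
      rw [show (4 : ℝ) = 2 ^ 2 by norm_num, Real.log_pow] at h5
      push_cast at h5
      linarith [Real.log_two_lt_d9]
    nlinarith [Real.log_two_lt_d9, (Nat.cast_nonneg k : (0 : ℝ) ≤ k)]
  have i1 := integral_max_rpow_le_of_one_le hd hd1 hαp
  have i2 := integral_max_rpow_le_of_one_lt hd hd1 (c := α * p + j * p) (by linarith)
  have h3 : 2 * (1 + 1 / (α * p + j * p - 1)) ≤ 4 := by
    have : 1 / (α * p + j * p - 1) ≤ 1 := by
      rw [div_le_one (by linarith)]
      linarith
    linarith
  have hkp : (k + 1 : ℝ) ≤ (k + 1) ^ p := by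
    simpa using Real.rpow_le_rpow_of_exponent_le hk1 hp
  calc _ ≤ ∫ θ in (-Real.pi)..Real.pi, 2 ^ p * (2 ^ (k * (j * p)) * max d |θ| ^ (-(α * p)) +
        (k + 1) ^ p * max d |θ| ^ (-(α * p + j * p))) := by
        refine intervalIntegral.integral_mono (by linarith [Real.pi_pos]) ?_ ?_ hpt
        · exact ((continuous_blockKernel α j k).rpow_const
            fun _ => Or.inr hp0.le).intervalIntegrable _ _
        · exact Continuous.intervalIntegrable (by fun_prop) _ _
    _ = 2 ^ p * (2 ^ (k * (j * p)) * (∫ θ in (-Real.pi)..Real.pi, max d |θ| ^ (-(α * p))) +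
        (k + 1) ^ p * ∫ θ in (-Real.pi)..Real.pi, max d |θ| ^ (-(α * p + j * p))) := by
      rw [intervalIntegral.integral_const_mul, intervalIntegral.integral_add
        (Continuous.intervalIntegrable (by fun_prop) _ _)
        (Continuous.intervalIntegrable (by fun_prop) _ _),
        intervalIntegral.integral_const_mul, intervalIntegral.integral_const_mul]
    -- The constant 10 is `2 · 3` from the logarithmic integral plus 4 from the other one.
    _ ≤ 2 ^ p * (2 ^ (k * (j * p)) * (2 * (3 * (k + 1) ^ p) * d ^ (1 - α * p)) +
        (k + 1) ^ p * (4 * d ^ (1 - (α * p + j * p)))) := by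
      gcongr
      · refine i1.trans ?_
        gcongr
        linarith
      · refine i2.trans ?_
        gcongr
    _ = _ := by
      rw [hdef, half_pow_rpow, half_pow_rpow]
      have e1 : (2 : ℝ) ^ (k * (j * p)) * 2 ^ (-(k * (1 - α * p))) =
          2 ^ (k * (α * p + j * p - 1)) := by
        rw [← Real.rpow_add (by norm_num)]
        ring_nf
      have e2 : (2 : ℝ) ^ (-(k * (1 - (α * p + j * p)))) = 2 ^ (k * (α * p + j * p - 1)) := by
        ring_nf
      rw [e2, ← e1]
      ring

/-- Polar coordinates; the Jacobian is at most 1 because `b ≤ 1`. -/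
lemma setLIntegral_annulus_arg_le {g : ℝ → ℝ≥0∞} (hg : Measurable g) {a b : ℝ} (hb : b ≤ 1) :
    ∫⁻ z in {z : ℂ | a ≤ ‖z‖ ∧ ‖z‖ < b}, g z.arg ≤
      ENNReal.ofReal (b - a) * ∫⁻ θ in Set.Ioo (-Real.pi) Real.pi, g θ := by
  have hA : MeasurableSet {z : ℂ | a ≤ ‖z‖ ∧ ‖z‖ < b} :=
    (measurableSet_le measurable_const measurable_norm).inter
      (measurableSet_lt measurable_norm measurable_const)
  rw [← lintegral_indicator hA, ← Complex.lintegral_comp_polarCoord_symm]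
  have hT : MeasurableSet polarCoord.target := polarCoord.open_target.measurableSet
  calc _ ≤ ∫⁻ q in polarCoord.target, (Set.Ico a b).indicator 1 q.1 * g q.2 := by
        refine setLIntegral_mono' hT fun q hq => ?_
        have hq1 : 0 < q.1 := hq.1
        have harg : (Complex.polarCoord.symm q).arg = q.2 := by
          rw [Complex.polarCoord_symm_apply]
          have := Complex.arg_mul_cos_add_sin_mul_I hq1 (Set.Ioo_subset_Ioc_self hq.2)
          push_cast
          exact this
        have hn : ‖Complex.polarCoord.symm q‖ = q.1 := by
          rw [Complex.norm_polarCoord_symm, abs_of_pos hq1]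
        by_cases h : a ≤ q.1 ∧ q.1 < b
        · rw [Set.indicator_of_mem (by simpa only [Set.mem_ofPred_eq, hn] using h), harg,
            Set.indicator_of_mem (Set.mem_Ico.2 h), smul_eq_mul]
          gcongr
          simpa using h.2.le.trans hb
        · rw [Set.indicator_of_notMem (by simpa only [Set.mem_ofPred_eq, hn] using h)]
          simp
    _ = (∫⁻ r in Set.Ioi (0 : ℝ), (Set.Ico a b).indicator 1 r) *
        ∫⁻ θ in Set.Ioo (-Real.pi) Real.pi, g θ := by
      rw [show polarCoord.target = Set.Ioi (0 : ℝ) ×ˢ Set.Ioo (-Real.pi) Real.pi from rfl,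
        Measure.volume_eq_prod, ← Measure.prod_restrict]
      exact lintegral_prod_mul ((measurable_one.indicator measurableSet_Ico).aemeasurable)
        hg.aemeasurable
    _ ≤ _ := by
      gcongr
      refine (setLIntegral_le_lintegral _ _).trans_eq ?_
      rw [lintegral_indicator_one measurableSet_Ico, Real.volume_Ico]

lemma lintegral_Ioo_ofReal {g : ℝ → ℝ} (hg : Continuous g) (h0 : ∀ θ, 0 ≤ g θ) :
    ∫⁻ θ in Set.Ioo (-Real.pi) Real.pi, ENNReal.ofReal (g θ) =
      ENNReal.ofReal (∫ θ in (-Real.pi)..Real.pi, g θ) := by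
  rw [intervalIntegral.integral_of_le (by linarith [Real.pi_pos]), integral_Ioc_eq_integral_Ioo,
    ofReal_integral_eq_lintegral_ofReal _ (ae_of_all _ h0)]
  exact (hg.integrableOn_Icc).mono_set Set.Ioo_subset_Icc_self

/-! ### Integrability of the dominating function -/

/-- Hölder's inequality against the geometric weights `ρ^(m-k)`, whose total mass is bounded in `m`.
The choice `ρ = b^(-1/p)` makes the loss `ρ^(-p(m-k)) = b^(m-k)`, so no power of `m` is lost. -/
lemma exists_rpow_sum_range_le {p b : ℝ} (hp : 1 ≤ p) (hb : 1 < b) :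
    ∃ C : ℝ, 0 ≤ C ∧ ∀ (m : ℕ) (x : ℕ → ℝ), (∀ k, 0 ≤ x k) →
      (∑ k ∈ Finset.range (m + 1), x k) ^ p ≤
        C * ∑ k ∈ Finset.range (m + 1), b ^ (m - k) * x k ^ p := by
  have hp0 : 0 < p := by linarith
  have hb0 : 0 < b := by linarith
  set ρ : ℝ := b ^ (-p⁻¹) with hρ
  have hρ0 : 0 < ρ := by positivity
  have hρ1 : ρ < 1 := Real.rpow_lt_one_of_one_lt_of_neg hb (by simpa using hp0)
  have hρp : ρ ^ p = b⁻¹ := by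
    rw [hρ, ← Real.rpow_mul hb0.le, neg_mul, inv_mul_cancel₀ hp0.ne', Real.rpow_neg_one]
  refine ⟨(1 - ρ)⁻¹ ^ (p - 1), Real.rpow_nonneg (inv_nonneg.2 (by linarith)) _,
    fun m x hx => ?_⟩
  set s := Finset.range (m + 1) with hs
  have hsum : ∑ k ∈ s, ρ ^ (m - k) ≤ (1 - ρ)⁻¹ := by
    rw [hs]
    have h2 : ∑ k ∈ Finset.range (m + 1), ρ ^ (m - k) =
        ∑ k ∈ Finset.range (m + 1), ρ ^ (m + 1 - 1 - k) := by simp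
    rw [h2, Finset.sum_range_reflect (fun k => ρ ^ k) (m + 1),
      ← tsum_geometric_of_lt_one hρ0.le hρ1]
    exact (summable_geometric_of_lt_one hρ0.le hρ1).sum_le_tsum _ fun k _ => by positivity
  have hsum0 : 0 ≤ ∑ k ∈ s, ρ ^ (m - k) := Finset.sum_nonneg fun k _ => by positivity
  have key := Real.inner_le_weight_mul_Lp_of_nonneg s hp (fun k => ρ ^ (m - k))
    (fun k => x k / ρ ^ (m - k)) (fun k => by positivity)
    (fun k => div_nonneg (hx k) (by positivity))
  have hx' : ∑ k ∈ s, ρ ^ (m - k) * (x k / ρ ^ (m - k)) = ∑ k ∈ s, x k :=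
    Finset.sum_congr rfl fun k _ => by field_simp
  rw [hx'] at key
  have hterm : ∀ k, ρ ^ (m - k) * (x k / ρ ^ (m - k)) ^ p ≤ b ^ (m - k) * x k ^ p := fun k => by
    rw [Real.div_rpow (hx k) (by positivity), ← Real.rpow_natCast ρ, ← Real.rpow_mul hρ0.le,
      mul_comm ((m - k : ℕ) : ℝ) p, Real.rpow_mul hρ0.le, hρp, Real.rpow_natCast,
      Real.rpow_natCast, inv_pow, div_inv_eq_mul, mul_comm (b ^ (m - k))]
    exact mul_le_of_le_one_left (mul_nonneg (Real.rpow_nonneg (hx k) _) (by positivity))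
      (pow_le_one₀ hρ0.le hρ1.le)
  have hY : 0 ≤ ∑ k ∈ s, ρ ^ (m - k) * (x k / ρ ^ (m - k)) ^ p :=
    Finset.sum_nonneg fun k _ => mul_nonneg (by positivity)
      (Real.rpow_nonneg (div_nonneg (hx k) (by positivity)) _)
  calc _ ≤ ((∑ k ∈ s, ρ ^ (m - k)) ^ (1 - p⁻¹) *
        (∑ k ∈ s, ρ ^ (m - k) * (x k / ρ ^ (m - k)) ^ p) ^ p⁻¹) ^ p :=
        Real.rpow_le_rpow (Finset.sum_nonneg fun k _ => hx k) key hp0.le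
    _ = (∑ k ∈ s, ρ ^ (m - k)) ^ (p - 1) *
        ∑ k ∈ s, ρ ^ (m - k) * (x k / ρ ^ (m - k)) ^ p := by
      rw [Real.mul_rpow (by positivity) (by positivity), ← Real.rpow_mul hsum0,
        ← Real.rpow_mul hY, inv_mul_cancel₀ hp0.ne', Real.rpow_one, sub_mul, one_mul,
        inv_mul_cancel₀ hp0.ne']
    _ ≤ _ := mul_le_mul (Real.rpow_le_rpow hsum0 hsum (by linarith))
      (Finset.sum_le_sum fun k _ => hterm k) hY
      (Real.rpow_nonneg (inv_nonneg.2 (by linarith)) _)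

/-- The dyadic annulus `1 - 2^(-m) ≤ |z| < 1 - 2^(-m-1)`. -/
def annulus (m : ℕ) : Set ℂ := {z | 1 - (1 / 2) ^ m ≤ ‖z‖ ∧ ‖z‖ < 1 - (1 / 2) ^ (m + 1)}

lemma measurableSet_annulus (m : ℕ) : MeasurableSet (annulus m) :=
  (measurableSet_le measurable_const measurable_norm).inter
    (measurableSet_lt measurable_norm measurable_const)

/-- The index of the dyadic annulus that contains a point of the disk. -/
def level (z : ℂ) : ℕ := sInf {m | ‖z‖ < 1 - (1 / 2) ^ (m + 1)}

lemma level_eq {z : ℂ} {m : ℕ} (hz : z ∈ annulus m) : level z = m := by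
  refine le_antisymm (Nat.sInf_le hz.2) (le_csInf ⟨m, hz.2⟩ fun i hi => ?_)
  by_contra hc
  push Not at hc
  have h1 : (1 / 2 : ℝ) ^ m ≤ (1 / 2) ^ (i + 1) :=
    pow_le_pow_of_le_one (by norm_num) (by norm_num) hc
  have h2 : ‖z‖ < 1 - (1 / 2) ^ (i + 1) := hi
  linarith [hz.1]

lemma exists_mem_annulus {z : ℂ} (hz : z ∈ disk) : ∃ m, z ∈ annulus m := by
  have h := mem_disk.1 hz
  obtain ⟨m, h1, h2⟩ := exists_nat_pow_near_of_lt_one (x := 1 - ‖z‖) (y := (1 / 2 : ℝ))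
    (by linarith) (by linarith [norm_nonneg z]) (by norm_num) (by norm_num)
  exact ⟨m, by linarith, by linarith⟩

/-- The sum `∑_{k ≤ m} ν_k K_k(θ)` of block kernels weighted by the masses of the tails. -/
def blockSum (μ : Measure (Set.Ico (0 : ℝ) 1)) (α : ℝ) (j m : ℕ) (θ : ℝ) : ℝ :=
  ∑ k ∈ Finset.range (m + 1), μ.real (tailSet k) * blockKernel α j k θ

/-- A majorant of the `j`-th derivative of the image of the unit ball of the Bloch space. -/
def majorant (μ : Measure (Set.Ico (0 : ℝ) 1)) (α : ℝ) (j : ℕ) (z : ℂ) : ℝ :=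
  blockSum μ α j (level z) z.arg

lemma blockSum_nonneg (μ : Measure (Set.Ico (0 : ℝ) 1)) (α : ℝ) (j m : ℕ) (θ : ℝ) :
    0 ≤ blockSum μ α j m θ :=
  Finset.sum_nonneg fun _ _ => mul_nonneg measureReal_nonneg (blockKernel_nonneg _ _ _ _)

lemma lintegral_area_eq (u : ℂ → ℝ≥0∞) :
    ∫⁻ z, u z ∂area = ENNReal.ofReal Real.pi⁻¹ * ∫⁻ z in disk, u z := by
  rw [area, lintegral_smul_measure, smul_eq_mul]

/-- The exponent `e = jp - 2` is negative for `1 < p < 2`, so either edge of the annulus may be the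
extremal one; the factor `2^|e|` covers both cases. -/
lemma weight_le {z : ℂ} {m : ℕ} (hz : z ∈ annulus m) (e : ℝ) :
    (1 - ‖z‖) ^ e ≤ 2 ^ |e| * 2 ^ (-(m * e)) := by
  have h1 : 1 - ‖z‖ ≤ (1 / 2) ^ m := by linarith [hz.1]
  have h2 : (1 / 2) ^ (m + 1) ≤ 1 - ‖z‖ := by linarith [hz.2]
  have h0 : (0 : ℝ) < (1 / 2) ^ (m + 1) := by positivity
  rw [← half_pow_rpow]
  rcases le_total 0 e with he | he
  · calc _ ≤ ((1 / 2 : ℝ) ^ m) ^ e := Real.rpow_le_rpow (h0.le.trans h2) h1 he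
      _ ≤ _ := le_mul_of_one_le_left (by positivity)
        (Real.one_le_rpow (by norm_num) (abs_nonneg _))
  · calc _ ≤ ((1 / 2 : ℝ) ^ (m + 1)) ^ e := Real.rpow_le_rpow_of_nonpos h0 h2 he
      _ = _ := by
        rw [pow_succ, Real.mul_rpow (by positivity) (by positivity), abs_of_nonpos he, mul_comm,
          one_div, Real.inv_rpow (by norm_num), Real.rpow_neg (by norm_num)]

/-- With `η = jp - 1`, the weight and the width of the `m`-th annulus contribute `2^(-mη)`, while
the `k`-th kernel contributes `(k+1)^p 2^(k(αp + η))`. Up to constants and the Hölder loss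
`b^(m-k)`, the annulus therefore carries the convolution of the given summable sequence with
`2^(-η(m-k))`, and this is summable in `m`. -/
lemma lintegral_majorant_lt_top (μ : Measure (Set.Ico (0 : ℝ) 1)) {α p : ℝ} {j : ℕ} (hp : 1 ≤ p)
    (hαp : 1 ≤ α * p) (hjp : 1 < j * p)
    (hs : Summable fun k : ℕ => μ.real (tailSet k) ^ p * (k + 1) ^ p * 2 ^ (k * (α * p))) :
    ∫⁻ z, ENNReal.ofReal (majorant μ α j z) ^ p * ENNReal.ofReal ((1 - ‖z‖) ^ (j * p - 2)) ∂area
      < ∞ := by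
  have hp0 : 0 < p := by linarith
  set η : ℝ := j * p - 1 with hη
  have hη0 : 0 < η := by linarith
  set e : ℝ := j * p - 2 with he
  -- Half of the decay `2^(-η(m-k))` pays for Hölder's inequality; the other half, `b^(-(m-k))`,
  -- remains to be summed.
  set b : ℝ := 2 ^ (η / 2) with hb
  have hb1 : 1 < b := Real.one_lt_rpow (by norm_num) (by positivity)
  have hb0 : 0 < b := by linarith
  obtain ⟨C, hC, hJ⟩ := exists_rpow_sum_range_le hp hb1
  set y : ℕ → ℝ := fun k => μ.real (tailSet k) ^ p * (k + 1) ^ p * 2 ^ (k * (α * p)) with hy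
  set c : ℕ → ℝ := fun m => C * 2 ^ |e| * (2 ^ p * 10) *
    ∑ k ∈ Finset.range (m + 1), y k * b⁻¹ ^ (m - k) with hc
  have hcs : Summable c := by
    refine Summable.mul_left _ (summable_norm_sum_mul_range_of_summable_norm hs.norm ?_).of_norm
    exact (summable_geometric_of_lt_one (by positivity) (inv_lt_one_of_one_lt₀ hb1)).norm
  have hann : ∀ m, ∫⁻ z in annulus m, ENNReal.ofReal (majorant μ α j z) ^ p *
      ENNReal.ofReal ((1 - ‖z‖) ^ e) ≤ ENNReal.ofReal (c m) := fun m => by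
    set g : ℝ → ℝ := fun θ => C * 2 ^ |e| * 2 ^ (-(m * e)) * ∑ k ∈ Finset.range (m + 1),
      b ^ (m - k) * (μ.real (tailSet k) ^ p * blockKernel α j k θ ^ p) with hg
    have hK : ∀ k θ, 0 ≤ blockKernel α j k θ := blockKernel_nonneg α j
    have hKc : ∀ k, Continuous fun θ => blockKernel α j k θ ^ p := fun k =>
      (continuous_blockKernel α j k).rpow_const fun _ => Or.inr hp0.le
    have hgc : Continuous g := continuous_const.mul (continuous_finsetSum _ fun k _ =>
      continuous_const.mul (continuous_const.mul (hKc k)))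
    have hg0 : ∀ θ, 0 ≤ g θ := fun θ => mul_nonneg (by positivity)
      (Finset.sum_nonneg fun k _ => by have := hK k θ; positivity)
    have hgi : ∫ θ in (-Real.pi)..Real.pi, g θ ≤ 2 ^ (m : ℝ) * c m := by
      have h1 : ∫ θ in (-Real.pi)..Real.pi, g θ = C * 2 ^ |e| * 2 ^ (-(m * e)) *
          ∑ k ∈ Finset.range (m + 1), b ^ (m - k) * (μ.real (tailSet k) ^ p *
            ∫ θ in (-Real.pi)..Real.pi, blockKernel α j k θ ^ p) := by
        rw [hg, intervalIntegral.integral_const_mul, intervalIntegral.integral_finsetSum]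
        · simp_rw [intervalIntegral.integral_const_mul]
        · exact fun k _ => (continuous_const.mul
            (continuous_const.mul (hKc k))).intervalIntegrable _ _
      rw [h1]
      calc _ ≤ C * 2 ^ |e| * 2 ^ (-(m * e)) *
            ∑ k ∈ Finset.range (m + 1), b ^ (m - k) * (μ.real (tailSet k) ^ p *
              (2 ^ p * 10 * ((k + 1) ^ p * 2 ^ (k * (α * p + j * p - 1))))) := by
            gcongr with k
            exact integral_blockKernel_rpow_le hp hαp hjp.le k
        _ = _ := by
          rw [hc]
          simp only [Finset.mul_sum]
          refine Finset.sum_congr rfl fun k hk => ?_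
          have hkm : k ≤ m := Nat.lt_succ_iff.1 (Finset.mem_range.1 hk)
          have hpow : (2 : ℝ) ^ (-(m * e)) * b ^ (m - k) * 2 ^ (k * (α * p + j * p - 1)) =
              2 ^ (m : ℝ) * 2 ^ (k * (α * p)) * b⁻¹ ^ (m - k) := by
            rw [hb, ← Real.rpow_neg (by norm_num), ← Real.rpow_mul_natCast (by norm_num),
              ← Real.rpow_mul_natCast (by norm_num), Nat.cast_sub hkm,
              ← Real.rpow_add (by norm_num), ← Real.rpow_add (by norm_num),
              ← Real.rpow_add (by norm_num), ← Real.rpow_add (by norm_num)]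
            congr 1
            rw [hη, he]
            ring
          rw [hy]
          linear_combination (C * 2 ^ |e| * 2 ^ p * 10 * μ.real (tailSet k) ^ p *
            ((k : ℝ) + 1) ^ p) * hpow
    calc _ ≤ ∫⁻ z in annulus m, ENNReal.ofReal (g z.arg) := by
          refine setLIntegral_mono' (measurableSet_annulus m) fun z hz => ?_
          have h0 : 0 ≤ blockSum μ α j m z.arg := blockSum_nonneg _ _ _ _ _
          rw [majorant, level_eq hz, ENNReal.ofReal_rpow_of_nonneg h0 hp0.le,
            ← ENNReal.ofReal_mul (by positivity)]
          apply ENNReal.ofReal_le_ofReal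
          have h1 := hJ m (fun k => μ.real (tailSet k) * blockKernel α j k z.arg)
            fun k => mul_nonneg measureReal_nonneg (hK _ _)
          have h1' : blockSum μ α j m z.arg ^ p ≤ C * ∑ k ∈ Finset.range (m + 1),
              b ^ (m - k) * (μ.real (tailSet k) ^ p * blockKernel α j k z.arg ^ p) := by
            refine h1.trans_eq ?_
            simp_rw [Real.mul_rpow measureReal_nonneg (hK _ _)]
          have h2 := weight_le hz e
          calc _ ≤ (C * ∑ k ∈ Finset.range (m + 1),
                b ^ (m - k) * (μ.real (tailSet k) ^ p * blockKernel α j k z.arg ^ p)) *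
                (2 ^ |e| * 2 ^ (-(m * e))) :=
                mul_le_mul h1' h2 (Real.rpow_nonneg (by
                  have := hz.2
                  have : (0 : ℝ) < (1 / 2) ^ (m + 1) := by positivity
                  linarith) _) ((Real.rpow_nonneg h0 p).trans h1')
            _ = _ := by rw [hg]; ring
      _ ≤ ENNReal.ofReal ((1 - (1 / 2) ^ (m + 1)) - (1 - (1 / 2) ^ m)) *
          ∫⁻ θ in Set.Ioo (-Real.pi) Real.pi, ENNReal.ofReal (g θ) :=
        setLIntegral_annulus_arg_le hgc.measurable.ennreal_ofReal
          (by linarith [pow_pos (by norm_num : (0 : ℝ) < 1 / 2) (m + 1)])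
      _ ≤ _ := by
        rw [lintegral_Ioo_ofReal hgc hg0, ← ENNReal.ofReal_mul (by
          have : (0 : ℝ) ≤ (1 / 2) ^ m := by positivity
          rw [pow_succ]
          linarith)]
        apply ENNReal.ofReal_le_ofReal
        have hh : (1 - (1 / 2 : ℝ) ^ (m + 1)) - (1 - (1 / 2) ^ m) = (1 / 2) * (1 / 2) ^ m := by
          rw [pow_succ]
          ring
        have hc0 : 0 ≤ c m := mul_nonneg (by positivity) (Finset.sum_nonneg fun k _ => by
          rw [hy]
          positivity)
        rw [hh]
        calc _ ≤ 1 / 2 * (1 / 2) ^ m * (2 ^ (m : ℝ) * c m) := by gcongr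
          _ = c m / 2 := by
            rw [Real.rpow_natCast, one_div, inv_pow]
            field_simp
          _ ≤ c m := by linarith
  have hcover : disk ⊆ ⋃ m, annulus m := fun z hz => Set.mem_iUnion.2 (exists_mem_annulus hz)
  rw [lintegral_area_eq]
  refine ENNReal.mul_lt_top ENNReal.ofReal_lt_top ?_
  calc _ ≤ ∑' m, ENNReal.ofReal (c m) :=
        (lintegral_mono_set hcover).trans
          ((lintegral_iUnion_le _ _).trans (ENNReal.tsum_le_tsum hann))
    _ < ∞ := hcs.tsum_ofReal_lt_top

lemma exists_norm_iteratedDeriv_le_majorant (μ : Measure (Set.Ico (0 : ℝ) 1)) [IsFiniteMeasure μ]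
    {α : ℝ} (hα : 0 < α) (j : ℕ) :
    ∃ C : ℝ, 0 ≤ C ∧ ∀ (M : ℝ) (f : Hol), f ∈ blochBall M → ∀ z ∈ disk,
      ‖iteratedDeriv j (cesaroIntegral μ α f) z‖ ≤ C * M * majorant μ α j z := by
  obtain ⟨C, hC, h⟩ := exists_norm_iteratedDeriv_cesaroIntegral_le μ hα j
  refine ⟨C, hC, fun M f hf z hz => ?_⟩
  obtain ⟨m, hm⟩ := exists_mem_annulus hz
  rw [majorant, level_eq hm]
  exact h M f hf z m (by linarith [hm.2])

/-! ### Dyadic condensation -/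

lemma sum_range_sum_dyadic_block (u : ℕ → ℝ) (M : ℕ) :
    u 0 + ∑ m ∈ Finset.range M, ∑ n ∈ Finset.Ico (2 ^ m) (2 ^ (m + 1)), u n =
      ∑ n ∈ Finset.range (2 ^ M), u n := by
  induction M with
  | zero => simp
  | succ M ih =>
    rw [Finset.sum_range_succ, ← add_assoc, ih, Finset.range_eq_Ico, Finset.range_eq_Ico,
      Finset.sum_Ico_consecutive _ (Nat.zero_le _) (Nat.pow_le_pow_right two_pos (Nat.le_succ M))]

lemma summable_of_dyadic_block_le {u v : ℕ → ℝ} (hu : ∀ n, 0 ≤ u n) (hv : Summable v)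
    (h : ∀ m, ∑ n ∈ Finset.Ico (2 ^ m) (2 ^ (m + 1)), u n ≤ v m) : Summable u := by
  have hv0 : ∀ m, 0 ≤ v m := fun m => (Finset.sum_nonneg fun n _ => hu n).trans (h m)
  refine summable_of_sum_range_le (c := u 0 + ∑' m, v m) hu fun n => ?_
  calc _ ≤ ∑ i ∈ Finset.range (2 ^ n), u i :=
        Finset.sum_le_sum_of_subset_of_nonneg
          (Finset.range_subset_range.2 Nat.lt_two_pow_self.le) fun i _ _ => hu i
    _ ≤ _ := by
      rw [← sum_range_sum_dyadic_block]
      gcongr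
      exact (Finset.sum_le_sum fun m _ => h m).trans (hv.sum_le_tsum _ fun m _ => hv0 m)

lemma summable_dyadic_block {u : ℕ → ℝ} (hu : ∀ n, 0 ≤ u n) (hs : Summable u) :
    Summable fun m : ℕ => ∑ n ∈ Finset.Ico (2 ^ m) (2 ^ (m + 1)), u n := by
  refine summable_of_sum_range_le (c := ∑' n, u n) (fun m => Finset.sum_nonneg fun n _ => hu n)
    fun M => ?_
  have h := sum_range_sum_dyadic_block u M
  have h2 := hs.sum_le_tsum (Finset.range (2 ^ M)) fun n _ => hu n
  linarith [hu 0]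

/-! ### Moments and tails -/

lemma moment_nonneg (μ : Measure (Set.Ico (0 : ℝ) 1)) (n : ℕ) : 0 ≤ moment μ n :=
  integral_nonneg fun t => pow_nonneg t.2.1 n

section

variable (μ : Measure (Set.Ico (0 : ℝ) 1)) [IsFiniteMeasure μ]

lemma integrable_coe_pow (n : ℕ) : Integrable (fun t : Set.Ico (0 : ℝ) 1 => (t : ℝ) ^ n) μ :=
  Integrable.of_bound (C := 1)
    (Continuous.aestronglyMeasurable (by fun_prop)) (ae_of_all _ fun t => by
      rw [Real.norm_eq_abs, abs_of_nonneg (pow_nonneg t.2.1 n)]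
      exact pow_le_one₀ t.2.1 t.2.2.le)

lemma moment_antitone {m n : ℕ} (h : m ≤ n) : moment μ n ≤ moment μ m :=
  integral_mono (integrable_coe_pow μ n) (integrable_coe_pow μ m) fun t =>
    pow_le_pow_of_le_one t.2.1 t.2.2.le h

lemma tail_le_moment (k : ℕ) : μ.real (tailSet (k + 1)) ≤ 4 * moment μ (2 ^ (k + 1)) := by
  have h : ∀ t ∈ tailSet (k + 1), (1 / 4 : ℝ) ≤ (t : ℝ) ^ 2 ^ (k + 1) := fun t ht => by
    have h0 : (0 : ℝ) < (1 / 2) ^ (k + 1) := by positivity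
    have h1 : (1 / 2 : ℝ) ^ (k + 1) ≤ 1 := pow_le_one₀ (by norm_num) (by norm_num)
    -- Bernoulli at half the exponent gives `1/2`, which is then squared; at the full exponent
    -- `2^(k+1)` it would only give 0.
    have hb := one_add_mul_le_pow (a := -(1 / 2 : ℝ) ^ (k + 1)) (by linarith) (2 ^ k)
    have h2 : (1 : ℝ) + ((2 ^ k : ℕ) : ℝ) * -(1 / 2) ^ (k + 1) = 1 / 2 := by
      push_cast
      rw [pow_succ, one_div, inv_pow]
      field_simp
      norm_num
    rw [h2] at hb
    have ht' : 1 + -(1 / 2 : ℝ) ^ (k + 1) ≤ t := by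
      have : 1 - (1 / 2) ^ (k + 1) ≤ (t : ℝ) := ht
      linarith
    have h3 : (1 / 2 : ℝ) ≤ (t : ℝ) ^ 2 ^ k :=
      hb.trans (pow_le_pow_left₀ (by linarith) ht' _)
    rw [pow_succ 2 k, pow_mul]
    nlinarith
  have h2 : ∫ t, (tailSet (k + 1)).indicator (fun _ => (1 / 4 : ℝ)) t ∂μ ≤
      moment μ (2 ^ (k + 1)) := by
    refine integral_mono ((integrable_const _).indicator (measurableSet_tailSet _))
      (integrable_coe_pow μ _) fun t => ?_
    by_cases ht : t ∈ tailSet (k + 1)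
    · rw [Set.indicator_of_mem ht]
      exact h t ht
    · rw [Set.indicator_of_notMem ht]
      exact pow_nonneg t.2.1 _
  rw [integral_indicator_const _ (measurableSet_tailSet _), smul_eq_mul] at h2
  linarith

/-- The summand need not be monotone, but each of its factors is: `pα - 1 ≥ 0` makes the power
increasing, and the moments decrease. On the block `[2^m, 2^(m+1))` the moments are bounded below by
the one at the right end, so block `m` controls the condensed term `m + 1`. -/
lemma summable_condensed {α p : ℝ} (hp : 1 ≤ p) (hαp : 1 ≤ p * α)
    (hs : Summable fun n : ℕ => ((n : ℝ) + 1) ^ (p * α - 1) * moment μ n ^ p *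
      Real.log ((n : ℝ) + 2) ^ p) :
    Summable fun m : ℕ => (2 : ℝ) ^ (m * (α * p)) * (m + 1) ^ p * moment μ (2 ^ m) ^ p := by
  have hp0 : 0 < p := by linarith
  have hmom := moment_nonneg μ
  have hl : ∀ n : ℕ, 0 ≤ Real.log ((n : ℝ) + 2) := fun n =>
    Real.log_nonneg (by linarith [(Nat.cast_nonneg n : (0 : ℝ) ≤ n)])
  have hu : ∀ n : ℕ, 0 ≤ ((n : ℝ) + 1) ^ (p * α - 1) * moment μ n ^ p *
      Real.log ((n : ℝ) + 2) ^ p := fun n => by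
    have := hmom n
    have := hl n
    positivity
  rw [← summable_nat_add_iff 1]
  refine Summable.of_nonneg_of_le (fun m => ?_) (fun m => ?_)
    ((summable_dyadic_block hu hs).mul_left (2 ^ (α * p) * 6 ^ p))
  · have := hmom (2 ^ (m + 1))
    positivity
  have hterm : ∀ n : ℕ, n ∈ Finset.Ico (2 ^ m) (2 ^ (m + 1)) →
      ((2 : ℝ) ^ m) ^ (p * α - 1) * moment μ (2 ^ (m + 1)) ^ p * (((m : ℝ) + 2) / 6) ^ p ≤
        ((n : ℝ) + 1) ^ (p * α - 1) * moment μ n ^ p * Real.log ((n : ℝ) + 2) ^ p := fun n hn => by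
    rw [Finset.mem_Ico] at hn
    have h1 : (2 : ℝ) ^ m ≤ n := by exact_mod_cast hn.1
    -- From `2^(m+2) ≤ (n+2)^3` and `log 2 > 1/2`.
    have h2 : ((m : ℝ) + 2) / 6 ≤ Real.log ((n : ℝ) + 2) := by
      have h3 : Real.log ((2 : ℝ) ^ (m + 2)) ≤ Real.log (((n : ℝ) + 2) ^ 3) := by
        apply Real.log_le_log (by positivity)
        have h4 : (0 : ℝ) < 2 ^ m := by positivity
        calc (2 : ℝ) ^ (m + 2) = 2 ^ m * 2 * 2 := by ring
          _ ≤ (n + 2) * (n + 2) * (n + 2) := by gcongr <;> nlinarith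
          _ = _ := by ring
      rw [Real.log_pow, Real.log_pow] at h3
      push_cast at h3
      nlinarith [Real.log_two_gt_d9, (Nat.cast_nonneg m : (0 : ℝ) ≤ m)]
    have h5 := hmom (2 ^ (m + 1))
    have h6 := moment_antitone μ hn.2.le
    have := hl n
    have := hmom n
    gcongr
    · linarith
  have hsum := Finset.card_nsmul_le_sum _ _ _ hterm
  have hcard : ((2 ^ (m + 1) - 2 ^ m : ℕ) : ℝ) = 2 ^ m := by
    rw [pow_succ, Nat.mul_two, Nat.add_sub_cancel]
    push_cast
    rfl
  rw [Nat.card_Ico, nsmul_eq_mul, hcard] at hsum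
  refine (le_of_eq ?_).trans (mul_le_mul_of_nonneg_left hsum (by positivity))
  have e1 : (2 : ℝ) ^ m * (2 ^ m) ^ (p * α - 1) = 2 ^ (m * (α * p)) := by
    rw [← Real.rpow_natCast, ← Real.rpow_mul (by norm_num), ← Real.rpow_add (by norm_num)]
    ring_nf
  have e2 : (2 : ℝ) ^ (((m + 1 : ℕ) : ℝ) * (α * p)) = 2 ^ (α * p) * 2 ^ (m * (α * p)) := by
    rw [← Real.rpow_add (by norm_num)]
    push_cast
    ring_nf
  have e3 : (((m : ℝ) + 2) / 6) ^ p * 6 ^ p = (((m + 1 : ℕ) : ℝ) + 1) ^ p := by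
    rw [← Real.mul_rpow (by positivity) (by norm_num)]
    push_cast
    ring_nf
  rw [e2, ← e1, ← e3]
  ring

lemma summable_of_condensed {α p : ℝ} (hp : 1 ≤ p) (hαp : 1 ≤ p * α)
    (hs : Summable fun m : ℕ => (2 : ℝ) ^ (m * (α * p)) * (m + 1) ^ p * moment μ (2 ^ m) ^ p) :
    Summable fun n : ℕ => ((n : ℝ) + 1) ^ (p * α - 1) * moment μ n ^ p *
      Real.log ((n : ℝ) + 2) ^ p := by
  have hp0 : 0 < p := by linarith
  have hmom := moment_nonneg μ
  have hl : ∀ n : ℕ, 0 ≤ Real.log ((n : ℝ) + 2) := fun n =>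
    Real.log_nonneg (by linarith [(Nat.cast_nonneg n : (0 : ℝ) ≤ n)])
  refine summable_of_dyadic_block_le (fun n => ?_)
    (hs.mul_left (2 ^ (p * α - 1) * 2 ^ p)) fun m => ?_
  · have := hmom n
    have := hl n
    positivity
  have hterm : ∀ n : ℕ, n ∈ Finset.Ico (2 ^ m) (2 ^ (m + 1)) →
      ((n : ℝ) + 1) ^ (p * α - 1) * moment μ n ^ p * Real.log ((n : ℝ) + 2) ^ p ≤
      (2 * (2 : ℝ) ^ m) ^ (p * α - 1) * moment μ (2 ^ m) ^ p * (2 * ((m : ℝ) + 1)) ^ p :=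
      fun n hn => by
    rw [Finset.mem_Ico] at hn
    have h1 : (n : ℝ) + 1 ≤ 2 * 2 ^ m := by
      have : n + 1 ≤ 2 ^ (m + 1) := hn.2
      rw [← pow_succ']
      exact_mod_cast this
    have h2 : Real.log ((n : ℝ) + 2) ≤ 2 * ((m : ℝ) + 1) := by
      have h3 : Real.log ((n : ℝ) + 2) ≤ Real.log ((2 : ℝ) ^ (m + 2)) := by
        apply Real.log_le_log (by positivity)
        have h4 : (1 : ℝ) ≤ 2 ^ m := one_le_pow₀ (by norm_num)
        rw [pow_add]
        linarith
      rw [Real.log_pow] at h3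
      push_cast at h3
      nlinarith [Real.log_two_lt_d9, (Nat.cast_nonneg m : (0 : ℝ) ≤ m)]
    have h6 := moment_antitone μ hn.1
    have := hl n
    have := hmom n
    have := hmom (2 ^ m)
    gcongr
  have hsum := Finset.sum_le_card_nsmul _ _ _ hterm
  have hcard : ((2 ^ (m + 1) - 2 ^ m : ℕ) : ℝ) = 2 ^ m := by
    rw [pow_succ, Nat.mul_two, Nat.add_sub_cancel]
    push_cast
    rfl
  rw [Nat.card_Ico, nsmul_eq_mul, hcard] at hsum
  refine hsum.trans_eq ?_
  have e1 : (2 : ℝ) ^ m * (2 ^ m) ^ (p * α - 1) = 2 ^ (m * (α * p)) := by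
    rw [← Real.rpow_natCast, ← Real.rpow_mul (by norm_num), ← Real.rpow_add (by norm_num)]
    ring_nf
  rw [← e1, Real.mul_rpow (by norm_num) (by positivity), Real.mul_rpow (by norm_num) (by positivity)]
  ring

lemma summable_tail_of_condensed {α p : ℝ} (hp : 1 ≤ p)
    (hs : Summable fun m : ℕ => (2 : ℝ) ^ (m * (α * p)) * (m + 1) ^ p * moment μ (2 ^ m) ^ p) :
    Summable fun k : ℕ => μ.real (tailSet k) ^ p * (k + 1) ^ p * (2 : ℝ) ^ (k * (α * p)) := by
  have hp0 : 0 < p := by linarith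
  rw [← summable_nat_add_iff 1] at hs ⊢
  refine Summable.of_nonneg_of_le (fun k => by positivity) (fun k => ?_) (hs.mul_left (4 ^ p))
  calc _ ≤ (4 * moment μ (2 ^ (k + 1))) ^ p * (((k + 1 : ℕ) : ℝ) + 1) ^ p *
        (2 : ℝ) ^ (((k + 1 : ℕ) : ℝ) * (α * p)) := by
        gcongr
        exact tail_le_moment μ k
    _ = _ := by
      rw [Real.mul_rpow (by norm_num) (moment_nonneg μ _)]
      ring

end

/-! ### Area means of holomorphic functions -/

lemma enorm_mul_le_lintegral_circle {h : ℂ → ℂ} {c : ℂ} {R r : ℝ}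
    (hd : DifferentiableOn ℂ h (Metric.ball c R)) (hr0 : 0 < r) (hr : r < R) :
    ‖h c‖ₑ * ENNReal.ofReal (2 * Real.pi) ≤
      ∫⁻ θ in Set.Ioo (-Real.pi) Real.pi, ‖h (circleMap c r θ)‖ₑ := by
  have hpi := Real.pi_pos
  have hdc : DiffContOnCl ℂ h (Metric.ball c |r|) := by
    rw [abs_of_pos hr0]
    exact hd.diffContOnCl_ball (Metric.closedBall_subset_ball hr)
  have h1 := hdc.circleAverage
  rw [Real.circleAverage_eq_integral_add (-Real.pi),
    intervalIntegral.integral_comp_add_right (fun θ => h (circleMap c r θ))] at h1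
  have h2 : (0 : ℝ) + -Real.pi = -Real.pi := by ring
  have h3 : 2 * Real.pi + -Real.pi = Real.pi := by ring
  rw [h2, h3] at h1
  have h4 : ∫ θ in (-Real.pi)..Real.pi, h (circleMap c r θ) = (2 * Real.pi) • h c := by
    rw [← h1, smul_smul, mul_inv_cancel₀ (by positivity), one_smul]
  rw [intervalIntegral.integral_of_le (by linarith), integral_Ioc_eq_integral_Ioo] at h4
  calc _ = ‖(2 * Real.pi) • h c‖ₑ := by
        rw [enorm_smul, mul_comm, Real.enorm_of_nonneg (by positivity)]
    _ ≤ _ := by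
      rw [← h4]
      exact enorm_integral_le_lintegral_enorm _

lemma lintegral_Ioo_ofReal_id {R : ℝ} (hR : 0 < R) :
    ∫⁻ r in Set.Ioo 0 R, ENNReal.ofReal r = ENNReal.ofReal (R ^ 2 / 2) := by
  rw [← ofReal_integral_eq_lintegral_ofReal]
  · rw [← integral_Ioc_eq_integral_Ioo, ← intervalIntegral.integral_of_le hR.le, integral_id]
    norm_num
  · exact (continuous_id.integrableOn_Icc).mono_set Set.Ioo_subset_Icc_self
  · exact (ae_restrict_mem measurableSet_Ioo).mono fun r hr => hr.1.le

lemma enorm_mul_le_setLIntegral_ball {h : ℂ → ℂ} {c : ℂ} {R : ℝ} (hR : 0 < R) (hm : Measurable h)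
    (hd : DifferentiableOn ℂ h (Metric.ball c R)) :
    ‖h c‖ₑ * ENNReal.ofReal (Real.pi * R ^ 2) ≤ ∫⁻ z in Metric.ball c R, ‖h z‖ₑ := by
  rw [← lintegral_indicator measurableSet_ball, ← lintegral_add_left_eq_self _ c,
    ← Complex.lintegral_comp_polarCoord_symm]
  have hsub : Set.Ioo 0 R ×ˢ Set.Ioo (-Real.pi) Real.pi ⊆ polarCoord.target :=
    Set.prod_mono Set.Ioo_subset_Ioi_self subset_rfl
  have hcm : ∀ q : ℝ × ℝ, c + Complex.polarCoord.symm q = circleMap c q.1 q.2 := fun q => by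
    rw [Complex.polarCoord_symm_apply, circleMap, Complex.exp_mul_I]
    push_cast
    rfl
  have hmeas : Measurable fun q : ℝ × ℝ => ENNReal.ofReal q.1 * ‖h (circleMap c q.1 q.2)‖ₑ := by
    have : Continuous fun q : ℝ × ℝ => circleMap c q.1 q.2 := by
      unfold circleMap
      fun_prop
    exact measurable_fst.ennreal_ofReal.mul (hm.comp this.measurable).enorm
  calc _ = ∫⁻ r in Set.Ioo 0 R, ENNReal.ofReal r * (‖h c‖ₑ * ENNReal.ofReal (2 * Real.pi)) := by
        rw [lintegral_mul_const _ (by fun_prop), lintegral_Ioo_ofReal_id hR, mul_left_comm,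
          ← ENNReal.ofReal_mul (by positivity)]
        congr 2
        ring
    _ ≤ ∫⁻ r in Set.Ioo 0 R, ∫⁻ θ in Set.Ioo (-Real.pi) Real.pi,
        ENNReal.ofReal r * ‖h (circleMap c r θ)‖ₑ := by
      refine setLIntegral_mono' measurableSet_Ioo fun r hr => ?_
      rw [lintegral_const_mul']
      · gcongr
        exact enorm_mul_le_lintegral_circle hd hr.1 hr.2
      · exact ENNReal.ofReal_ne_top
    _ = ∫⁻ q in Set.Ioo 0 R ×ˢ Set.Ioo (-Real.pi) Real.pi,
        ENNReal.ofReal q.1 * ‖h (circleMap c q.1 q.2)‖ₑ := by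
      rw [Measure.volume_eq_prod, ← Measure.prod_restrict, lintegral_prod _ hmeas.aemeasurable]
    _ ≤ ∫⁻ q in Set.Ioo 0 R ×ˢ Set.Ioo (-Real.pi) Real.pi, ENNReal.ofReal q.1 •
        (Metric.ball c R).indicator (fun z => ‖h z‖ₑ) (c + Complex.polarCoord.symm q) := by
      refine setLIntegral_mono' (measurableSet_Ioo.prod measurableSet_Ioo) fun q hq => ?_
      rw [hcm, Set.indicator_of_mem, smul_eq_mul]
      rw [mem_ball_iff_norm, circleMap_sub_center, norm_circleMap_zero, abs_of_pos hq.1.1]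
      exact hq.1.2
    _ ≤ _ := lintegral_mono_set hsub

/-- The case `p = 1` is the mean value property; Hölder's inequality on the disk, of area `V`,
raises it to the power `p`, and the common factor `V^(p-1)` cancels. -/
lemma enorm_rpow_mul_le_setLIntegral_ball {h : ℂ → ℂ} {c : ℂ} {R p : ℝ} (hp : 1 ≤ p) (hR : 0 < R)
    (hm : Measurable h) (hd : DifferentiableOn ℂ h (Metric.ball c R)) :
    ‖h c‖ₑ ^ p * ENNReal.ofReal (Real.pi * R ^ 2) ≤ ∫⁻ z in Metric.ball c R, ‖h z‖ₑ ^ p := by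
  have hp0 : 0 < p := by linarith
  set V := ENNReal.ofReal (Real.pi * R ^ 2) with hV
  have hV0 : V ≠ 0 := by
    have : 0 < Real.pi * R ^ 2 := by positivity
    simpa [hV] using this
  have hVt : V ≠ ∞ := ENNReal.ofReal_ne_top
  have hvol : volume (Metric.ball c R) = V := by
    rw [Complex.volume_ball, hV, mul_comm, ENNReal.ofReal_mul Real.pi_pos.le,
      ENNReal.ofReal_pow hR.le]
    congr 1
    rw [← NNReal.coe_real_pi, ENNReal.ofReal_coe_nnreal]
  set A := ∫⁻ z in Metric.ball c R, ‖h z‖ₑ ^ p with hA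
  have h1 := enorm_mul_le_setLIntegral_ball hR hm hd
  have h2 := eLpNorm'_le_eLpNorm'_mul_rpow_measure_univ (μ := volume.restrict (Metric.ball c R))
    one_pos hp hm.aestronglyMeasurable
  simp only [eLpNorm', ENNReal.rpow_one, div_one, Measure.restrict_apply_univ, hvol] at h2
  have h3 : (‖h c‖ₑ * V) ^ p ≤ (A ^ (1 / p) * V ^ (1 - 1 / p)) ^ p :=
    ENNReal.rpow_le_rpow (h1.trans h2) hp0.le
  rw [ENNReal.mul_rpow_of_nonneg _ _ hp0.le, ENNReal.mul_rpow_of_nonneg _ _ hp0.le,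
    ← ENNReal.rpow_mul, ← ENNReal.rpow_mul, one_div, inv_mul_cancel₀ hp0.ne', ENNReal.rpow_one,
    sub_mul, one_mul, inv_mul_cancel₀ hp0.ne'] at h3
  have h4 : V ^ p = V * V ^ (p - 1) := by
    nth_rewrite 2 [← ENNReal.rpow_one V]
    rw [← ENNReal.rpow_add _ _ hV0 hVt]
    congr 1
    ring
  rw [h4, ← mul_assoc] at h3
  have h5 : V ^ (p - 1) ≠ 0 := (ENNReal.rpow_pos (pos_iff_ne_zero.2 hV0) hVt).ne'
  exact (ENNReal.mul_le_mul_iff_left h5 (ENNReal.rpow_ne_top_of_nonneg (by linarith) hVt)).1 h3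

/-- The disk about `1 - 2^(-m)` with radius `2^(-m) / 8`. -/
def dyadicBall (m : ℕ) : Set ℂ := Metric.ball ((1 - (1 / 2) ^ m : ℝ) : ℂ) ((1 / 2) ^ m / 8)

lemma abs_le_of_mem_dyadicBall {m : ℕ} {z : ℂ} (hz : z ∈ dyadicBall m) :
    7 / 8 * (1 / 2) ^ m < 1 - ‖z‖ ∧ 1 - ‖z‖ < 9 / 8 * (1 / 2) ^ m := by
  have h0 : (0 : ℝ) < (1 / 2) ^ m := by positivity
  have h1 : (1 / 2 : ℝ) ^ m ≤ 1 := pow_le_one₀ (by norm_num) (by norm_num)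
  have hc : ‖((1 - (1 / 2) ^ m : ℝ) : ℂ)‖ = 1 - (1 / 2) ^ m := by
    rw [Complex.norm_real, Real.norm_eq_abs, abs_of_nonneg (by linarith)]
  have h2 : ‖z - ((1 - (1 / 2) ^ m : ℝ) : ℂ)‖ < (1 / 2) ^ m / 8 := mem_ball_iff_norm.1 hz
  have h3 := norm_sub_norm_le z ((1 - (1 / 2) ^ m : ℝ) : ℂ)
  have h4 := norm_sub_norm_le ((1 - (1 / 2) ^ m : ℝ) : ℂ) z
  rw [norm_sub_rev] at h4
  rw [hc] at h3 h4
  constructor <;> linarith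

lemma dyadicBall_subset_disk (m : ℕ) : dyadicBall m ⊆ disk := fun z hz => by
  rw [mem_disk]
  linarith [(abs_le_of_mem_dyadicBall hz).1, pow_pos (by norm_num : (0 : ℝ) < 1 / 2) m]

lemma pairwise_disjoint_dyadicBall : Pairwise (Function.onFun Disjoint dyadicBall) := by
  have key : ∀ m n : ℕ, m < n → Disjoint (dyadicBall m) (dyadicBall n) := fun m n hmn => by
    rw [Set.disjoint_left]
    intro z hm hn
    have h1 := (abs_le_of_mem_dyadicBall hm).1
    have h2 := (abs_le_of_mem_dyadicBall hn).2
    have h3 : (1 / 2 : ℝ) ^ n ≤ (1 / 2) ^ (m + 1) :=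
      pow_le_pow_of_le_one (by norm_num) (by norm_num) hmn
    rw [pow_succ] at h3
    linarith [pow_pos (by norm_num : (0 : ℝ) < 1 / 2) m]
  intro m n hmn
  rcases lt_or_gt_of_ne hmn with h | h
  · exact key m n h
  · exact (key n m h).symm

lemma rpow_ge_of_mem_Icc {x d : ℝ} (hd : 0 < d) (h1 : d / 2 ≤ x) (h2 : x ≤ 2 * d) (e : ℝ) :
    2 ^ (-|e|) * d ^ e ≤ x ^ e := by
  have hx : 0 < x := by linarith
  rcases le_total 0 e with he | he
  · calc _ = (d / 2) ^ e := by
          rw [Real.div_rpow hd.le (by norm_num), abs_of_nonneg he, Real.rpow_neg (by norm_num)]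
          ring
      _ ≤ _ := Real.rpow_le_rpow (by positivity) h1 he
  · calc _ = (2 * d) ^ e := by
          rw [Real.mul_rpow (by norm_num) hd.le, abs_of_nonpos he, neg_neg]
      _ ≤ _ := Real.rpow_le_rpow_of_nonpos hx h2 he

/-- The disks `dyadicBall m` are disjoint, have area comparable to `2^(-2m)`, and carry a weight
comparable to `2^(-me)`. The mean value inequality on each bounds the `m`-th term by the integral
over that disk. -/
lemma summable_norm_rpow_of_lintegral_lt_top {h : ℂ → ℂ} {p e : ℝ} (hp : 1 ≤ p)
    (hm : Measurable h) (hd : DifferentiableOn ℂ h disk)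
    (hfin : ∫⁻ z, ‖h z‖ₑ ^ p * ENNReal.ofReal ((1 - ‖z‖) ^ e) ∂area < ∞) :
    Summable fun m : ℕ => (2 : ℝ) ^ (-(m * (e + 2))) * ‖h ((1 - (1 / 2) ^ m : ℝ) : ℂ)‖ ^ p := by
  have hp0 : 0 < p := by linarith
  set x : ℕ → ℝ := fun m => (2 : ℝ) ^ (-(m * (e + 2))) * ‖h ((1 - (1 / 2) ^ m : ℝ) : ℂ)‖ ^ p with hx
  -- The first factor compares the weight with its value at the centre; `π/64` comes from the radius
  -- `2^(-m)/8`.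
  set K : ℝ := 2 ^ (-|e|) * (Real.pi / 64) with hK
  have hK0 : 0 < K := by positivity
  have hball : ∀ m, ENNReal.ofReal (K * x m) ≤ ∫⁻ z in dyadicBall m,
      ‖h z‖ₑ ^ p * ENNReal.ofReal ((1 - ‖z‖) ^ e) := fun m => by
    have hd0 : (0 : ℝ) < (1 / 2) ^ m := by positivity
    have h1 := enorm_rpow_mul_le_setLIntegral_ball (c := ((1 - (1 / 2) ^ m : ℝ) : ℂ))
      (R := (1 / 2) ^ m / 8) hp (by positivity) hm (hd.mono (dyadicBall_subset_disk m))
    calc _ = ‖h ((1 - (1 / 2) ^ m : ℝ) : ℂ)‖ₑ ^ p *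
          ENNReal.ofReal (Real.pi * ((1 / 2) ^ m / 8) ^ 2) *
          ENNReal.ofReal (2 ^ (-|e|) * ((1 / 2) ^ m) ^ e) := by
          rw [← ofReal_norm, ENNReal.ofReal_rpow_of_nonneg (norm_nonneg _) hp0.le,
            ← ENNReal.ofReal_mul (by positivity), ← ENNReal.ofReal_mul (by positivity)]
          congr 1
          have h2 : (2 : ℝ) ^ (-(m * (e + 2))) = ((1 / 2) ^ m) ^ 2 * ((1 / 2) ^ m) ^ e := by
            rw [← half_pow_rpow, Real.rpow_add hd0, mul_comm]
            norm_num
          rw [hx, hK]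
          simp only [h2]
          ring
      _ ≤ (∫⁻ z in dyadicBall m, ‖h z‖ₑ ^ p) * ENNReal.ofReal (2 ^ (-|e|) * ((1 / 2) ^ m) ^ e) := by
        gcongr
        exact h1
      _ = ∫⁻ z in dyadicBall m, ‖h z‖ₑ ^ p * ENNReal.ofReal (2 ^ (-|e|) * ((1 / 2) ^ m) ^ e) := by
        rw [lintegral_mul_const' _ _ ENNReal.ofReal_ne_top]
      _ ≤ _ := by
        refine setLIntegral_mono' measurableSet_ball fun z hz => ?_
        have h3 := abs_le_of_mem_dyadicBall hz
        gcongr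
        exact rpow_ge_of_mem_Icc hd0 (by linarith) (by linarith) e
  have htsum : ∑' m, ENNReal.ofReal (K * x m) ≠ ∞ := by
    refine ne_top_of_le_ne_top (b := ∫⁻ z in disk, ‖h z‖ₑ ^ p * ENNReal.ofReal ((1 - ‖z‖) ^ e))
      ?_ ?_
    · intro htop
      rw [lintegral_area_eq, htop, ENNReal.mul_top (by simpa using Real.pi_pos)] at hfin
      exact hfin.ne rfl
    · calc _ ≤ ∑' m, ∫⁻ z in dyadicBall m, ‖h z‖ₑ ^ p * ENNReal.ofReal ((1 - ‖z‖) ^ e) :=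
            ENNReal.tsum_le_tsum hball
        _ = ∫⁻ z in ⋃ m, dyadicBall m, ‖h z‖ₑ ^ p * ENNReal.ofReal ((1 - ‖z‖) ^ e) :=
            (lintegral_iUnion (fun m => measurableSet_ball) pairwise_disjoint_dyadicBall _).symm
        _ ≤ _ := lintegral_mono_set (Set.iUnion_subset dyadicBall_subset_disk)
  have hs := ENNReal.summable_toReal htsum
  have hs2 : Summable fun m => K * x m := by
    refine hs.congr fun m => ?_
    rw [ENNReal.toReal_ofReal (by positivity)]
  exact (summable_mul_left_iff hK0.ne').1 hs2

/-! ### The test function `1 - log (1 - z)` -/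

lemma differentiableAt_one_sub_log {z : ℂ} (hz : z ∈ disk) :
    DifferentiableAt ℂ (fun z => 1 - Complex.log (1 - z)) z :=
  (((hasDerivAt_id z).const_sub 1).clog (one_sub_mem_slitPlane hz)).differentiableAt.const_sub 1

open Classical in
/-- The function `1 - log (1 - z)` as an element of `H(𝔻)`. -/
def logHol : Hol :=
  ⟨fun z => if z ∈ disk then 1 - Complex.log (1 - z) else 0, by
    refine ⟨DifferentiableOn.congr (f := fun z => 1 - Complex.log (1 - z))
      (fun z hz => (differentiableAt_one_sub_log hz).differentiableWithinAt)
      fun z hz => if_pos hz, fun z hz => if_neg hz⟩⟩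

lemma logHol_apply {z : ℂ} (hz : z ∈ disk) : logHol z = 1 - Complex.log (1 - z) := if_pos hz

lemma norm_deriv_logHol {z : ℂ} (hz : z ∈ disk) : ‖deriv logHol z‖ = ‖1 - z‖⁻¹ := by
  have h : logHol.1 =ᶠ[nhds z] fun z => 1 - Complex.log (1 - z) :=
    Filter.eventuallyEq_of_mem (disk_mem_nhds hz) fun w hw => logHol_apply hw
  have h2 := (((hasDerivAt_id z).const_sub 1).clog (one_sub_mem_slitPlane hz)).const_sub 1
  rw [h.deriv_eq]
  erw [h2.deriv]
  simp

lemma integral_circle_one_sub_rpow_le {s r : ℝ} (hs : 1 < s) (hr0 : 0 ≤ r) (hr : r < 1) :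
    ∫ θ in (0 : ℝ)..2 * Real.pi, ‖1 - circleMap 0 r θ‖ ^ (-s) ≤
      Real.pi ^ s * (2 * (1 + 1 / (s - 1))) * (1 - r) ^ (1 - s) := by
  have hpi := Real.pi_gt_three
  have hd : 0 < 1 - r := by linarith
  have hper : Function.Periodic (fun θ : ℝ => ‖1 - circleMap 0 r θ‖ ^ (-s)) (2 * Real.pi) :=
    fun θ => by simp only [periodic_circleMap 0 r θ]
  have hn : ∀ θ, ‖circleMap 0 r θ‖ = r := fun θ => by simp [abs_of_nonneg hr0]
  have hlow : ∀ θ, 1 - r ≤ ‖1 - circleMap 0 r θ‖ := fun θ => by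
    simpa [hn] using one_sub_norm_le (circleMap 0 r θ)
  have h1 := hper.intervalIntegral_add_eq 0 (-Real.pi)
  rw [zero_add, show -Real.pi + 2 * Real.pi = Real.pi by ring] at h1
  rw [h1]
  have hc : Continuous fun θ : ℝ => ‖1 - circleMap 0 r θ‖ ^ (-s) :=
    (continuous_const.sub (continuous_circleMap 0 r)).norm.rpow_const fun θ =>
      Or.inl (hd.trans_le (hlow θ)).ne'
  calc _ ≤ ∫ θ in (-Real.pi)..Real.pi, Real.pi ^ s * max (1 - r) |θ| ^ (-s) := by
        refine intervalIntegral.integral_mono_on (by linarith) (hc.intervalIntegrable _ _)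
          ((continuous_const.mul (continuous_max_rpow hd _)).intervalIntegrable _ _) fun θ hθ => ?_
        have hm : 0 < max (1 - r) |θ| := lt_max_of_lt_left hd
        have h2 := abs_div_pi_le_norm_one_sub hr0 hr.le (abs_le.2 hθ)
        have h3 : max (1 - r) |θ| / Real.pi ≤ ‖1 - circleMap 0 r θ‖ := by
          rw [div_le_iff₀ Real.pi_pos]
          refine max_le ?_ ?_
          · nlinarith [hlow θ]
          · rw [div_le_iff₀ Real.pi_pos] at h2
            rwa [circleMap_zero, mul_comm (θ : ℂ)]
        calc _ ≤ (max (1 - r) |θ| / Real.pi) ^ (-s) :=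
              Real.rpow_le_rpow_of_nonpos (by positivity) h3 (by linarith)
          _ = _ := by
            rw [Real.div_rpow hm.le Real.pi_pos.le, Real.rpow_neg Real.pi_pos.le]
            field_simp
    _ ≤ _ := by
      rw [intervalIntegral.integral_const_mul, mul_assoc]
      gcongr
      exact integral_max_rpow_le_of_one_lt hd (by linarith) hs

/-- The integral of `|1 - re^{iθ}|^(-s)` is `O((1 - r)^(1-s))` because `s > 1`, and its `s`-th root
exactly offsets the weight `(1 - r)^(1 - 1/s)`. -/
lemma logHol_mem_meanLipschitz {s : ℝ} (hs : 1 < s) : logHol ∈ meanLipschitz s (1 / s) := by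
  have hs0 : 0 < s := by linarith
  have hs1 : 0 < s - 1 := by linarith
  set K : ℝ := (2 * Real.pi)⁻¹ * (Real.pi ^ s * (2 * (1 + 1 / (s - 1)))) with hK
  have hpi := Real.pi_pos
  have hK0 : 0 ≤ K := by positivity
  refine ⟨K ^ (1 / s), fun r hr0 hr => ?_⟩
  have hd : 0 < 1 - r := by linarith
  have hmem : ∀ θ, circleMap 0 r θ ∈ disk := fun θ => by
    rw [mem_disk]
    simpa [abs_of_nonneg hr0] using hr
  have h1 : ∫ θ in (0 : ℝ)..2 * Real.pi, ‖deriv logHol (circleMap 0 r θ)‖ ^ s =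
      ∫ θ in (0 : ℝ)..2 * Real.pi, ‖1 - circleMap 0 r θ‖ ^ (-s) := by
    congr 1
    funext θ
    rw [norm_deriv_logHol (hmem θ), Real.inv_rpow (norm_nonneg _), Real.rpow_neg (norm_nonneg _)]
  have h2 := integral_circle_one_sub_rpow_le hs hr0 hr
  have h0 : 0 ≤ ∫ θ in (0 : ℝ)..2 * Real.pi, ‖1 - circleMap 0 r θ‖ ^ (-s) :=
    intervalIntegral.integral_nonneg (by positivity) fun θ _ => by positivity
  rw [integralMean, h1]
  calc _ ≤ (1 - r) ^ (1 - 1 / s) * (K * (1 - r) ^ (1 - s)) ^ (1 / s) := by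
        refine mul_le_mul_of_nonneg_left (Real.rpow_le_rpow (by positivity) ?_ (by positivity))
          (by positivity)
        rw [hK, mul_assoc (2 * Real.pi)⁻¹]
        gcongr
    _ = K ^ (1 / s) := by
      rw [Real.mul_rpow hK0 (by positivity), ← Real.rpow_mul hd.le, mul_left_comm,
        ← Real.rpow_add hd]
      have : 1 - 1 / s + (1 - s) * (1 / s) = 0 := by field_simp; ring
      rw [this, Real.rpow_zero, mul_one]

/-! ### Lower bounds for the image of the test function -/

/-- Put `N = 2^m`, `y = 1 - t(1 - 1/N)` and `v = (1 - t)N`, so that `Ny = v + t ≤ 1 + v`. Replacing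
`N^a` by `y^(-a)` and `m + 1` by `1 - log y` costs a multiple of `(1 + v)^(a+1)`, while `t^N ≤ t^j
e^(-v/2)` absorbs every power of `1 + v`. -/
lemma exists_pow_le_kernel {a : ℝ} (ha : 0 < a) (j : ℕ) :
    ∃ C : ℝ, 0 < C ∧ ∀ m : ℕ, 2 * j ≤ 2 ^ m → ∀ t : ℝ, 0 ≤ t → t < 1 →
      2 ^ (m * a) * (m + 1) * t ^ 2 ^ m ≤ C * (t ^ j * ((1 - t * (1 - (1 / 2) ^ m)) ^ (-a) *
        (1 - Real.log (1 - t * (1 - (1 / 2) ^ m))))) := by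
  set B := a + 1 with hB
  have hB1 : 1 < B := by linarith
  refine ⟨2 * (2 * B) ^ B, by positivity, fun m hm t ht0 ht1 => ?_⟩
  set N : ℝ := 2 ^ m with hN
  have hN1 : 1 ≤ N := one_le_pow₀ (by norm_num)
  have hN0 : 0 < N := by linarith
  have hNinv : (1 / 2 : ℝ) ^ m = N⁻¹ := by rw [hN, one_div, inv_pow]
  set y := 1 - t * (1 - (1 / 2) ^ m) with hy
  set v := (1 - t) * N with hv
  have hv0 : 0 ≤ v := mul_nonneg (by linarith) hN0.le
  have hNy : N * y = v + t := by
    rw [hy, hNinv, hv]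
    field_simp
    ring
  have hy0 : 0 < y := by
    have : 0 < N * y := by
      rw [hNy]
      rcases ht0.eq_or_lt with h | h
      · rw [← h, hv, ← h]
        linarith
      · linarith
    exact (pos_iff_pos_of_mul_pos this).1 hN0
  have hy1 : y ≤ 1 := by
    have : N⁻¹ ≤ 1 := inv_le_one_of_one_le₀ hN1
    rw [hy, hNinv]
    nlinarith
  have hly : 0 ≤ -Real.log y := by linarith [Real.log_nonpos hy0.le hy1]
  have h1 : N ^ a ≤ (1 + v) ^ a * y ^ (-a) := by
    have h2 : (N * y) ^ a ≤ (1 + v) ^ a :=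
      Real.rpow_le_rpow (by positivity) (by rw [hNy]; linarith) ha.le
    rw [Real.mul_rpow hN0.le hy0.le] at h2
    rw [Real.rpow_neg hy0.le, ← div_eq_mul_inv, le_div_iff₀ (by positivity)]
    exact h2
  have h2 : (m : ℝ) + 1 ≤ 2 * ((1 + v) * (1 - Real.log y)) := by
    have h3 : Real.log N + Real.log y ≤ v := by
      rw [← Real.log_mul hN0.ne' hy0.ne', hNy]
      have h4 : 0 < v + t := by rw [← hNy]; positivity
      linarith [Real.log_le_sub_one_of_pos h4]
    rw [hN, Real.log_pow] at h3
    nlinarith [Real.log_two_gt_d9, (Nat.cast_nonneg m : (0 : ℝ) ≤ m), mul_nonneg hv0 hly]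
  have h3 : t ^ 2 ^ m ≤ t ^ j * Real.exp (-(v / 2)) := by
    have hj : j ≤ 2 ^ m := by omega
    rw [← pow_mul_pow_sub t hj]
    gcongr
    have h4 : t ≤ Real.exp (-(1 - t)) := by linarith [Real.add_one_le_exp (-(1 - t))]
    calc _ ≤ Real.exp (-(1 - t)) ^ (2 ^ m - j) := pow_le_pow_left₀ ht0 h4 _
      _ ≤ _ := by
        rw [← Real.exp_nat_mul, Nat.cast_sub hj]
        apply Real.exp_le_exp.2
        -- Removing the factor `t^j` leaves the exponent `N - j ≥ N/2`, whence the rate `v/2`.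
        have h5 : (2 : ℝ) * j ≤ N := by
          rw [hN]
          exact_mod_cast hm
        push_cast
        rw [← hN, hv]
        nlinarith
  have h4 : (1 + v) ^ B ≤ (2 * B) ^ B * Real.exp (v / 2) := by
    have h5 : 1 + v ≤ 2 * B * Real.exp (v / (2 * B)) := by
      have := Real.add_one_le_exp (v / (2 * B))
      have h6 : 2 * B * (v / (2 * B) + 1) = v + 2 * B := by field_simp
      nlinarith
    calc _ ≤ (2 * B * Real.exp (v / (2 * B))) ^ B :=
          Real.rpow_le_rpow (by linarith) h5 (by linarith)
      _ = _ := by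
        rw [Real.mul_rpow (by linarith) (Real.exp_pos _).le, ← Real.exp_mul]
        congr 2
        field_simp
  have h5 : (1 + v) ^ B = (1 + v) ^ a * (1 + v) := by
    rw [hB, Real.rpow_add (by linarith), Real.rpow_one]
  have hNa : (2 : ℝ) ^ (m * a) = N ^ a := by
    rw [hN, ← Real.rpow_natCast, ← Real.rpow_mul (by norm_num)]
  have hya : 0 < y ^ (-a) := by positivity
  have hl0 : 0 ≤ 1 - Real.log y := by linarith
  have htj : 0 ≤ t ^ j := by positivity
  rw [hNa]
  calc _ ≤ ((1 + v) ^ a * y ^ (-a)) * (2 * ((1 + v) * (1 - Real.log y))) *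
        (t ^ j * Real.exp (-(v / 2))) := by gcongr
    _ = (1 + v) ^ B * (2 * y ^ (-a) * (1 - Real.log y) * t ^ j * Real.exp (-(v / 2))) := by
      rw [h5]
      ring
    _ ≤ (2 * B) ^ B * Real.exp (v / 2) *
        (2 * y ^ (-a) * (1 - Real.log y) * t ^ j * Real.exp (-(v / 2))) := by gcongr
    _ = Real.exp (v / 2) * Real.exp (-(v / 2)) * (2 * (2 * B) ^ B) *
        (t ^ j * (y ^ (-a) * (1 - Real.log y))) := by ring
    _ = _ := by rw [← Real.exp_add, add_neg_cancel, Real.exp_zero, one_mul]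

section

variable (μ : Measure (Set.Ico (0 : ℝ) 1)) [IsFiniteMeasure μ]

/-- At a real point the integrand is real and nonnegative, so the modulus of the integral is the
integral; its logarithmic part alone dominates `t^(2^m)` pointwise. -/
lemma exists_moment_le_norm_iteratedDeriv {α : ℝ} (hα : 0 < α) (j : ℕ) :
    ∃ C : ℝ, 0 < C ∧ ∀ m : ℕ, 2 * j ≤ 2 ^ m →
      2 ^ (m * (α + j)) * (m + 1) * moment μ (2 ^ m) ≤
        C * ‖iteratedDeriv j (cesaroIntegral μ α logHol) ((1 - (1 / 2) ^ m : ℝ) : ℂ)‖ := by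
  obtain ⟨C, hC, hk⟩ := exists_pow_le_kernel (a := α + j) (by positivity) j
  obtain ⟨a, b, ha, hb, hab⟩ := exists_iteratedDeriv_logKernel hα j
  refine ⟨C / a, by positivity, fun m hm => ?_⟩
  have hd0 : (0 : ℝ) < (1 / 2) ^ m := by positivity
  have hd1 : (1 / 2 : ℝ) ^ m ≤ 1 := pow_le_one₀ (by norm_num) (by norm_num)
  set r : ℝ := 1 - (1 / 2) ^ m with hr
  have hrd : (r : ℂ) ∈ disk := by
    rw [mem_disk, Complex.norm_real, Real.norm_eq_abs, abs_of_nonneg (by linarith)]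
    linarith
  set φ : Set.Ico (0 : ℝ) 1 → ℝ := fun t => (t : ℝ) ^ j * ((1 - t * r) ^ (-(α + j)) *
    (a * (1 - Real.log (1 - t * r)) + b)) with hφ
  have htr : ∀ t : Set.Ico (0 : ℝ) 1, (t : ℝ) * r < 1 := fun t => by nlinarith [t.2.1, t.2.2]
  have heq : ∀ t : Set.Ico (0 : ℝ) 1, ((t : ℝ) : ℂ) ^ j *
      iteratedDeriv j (lift α logHol) (((t : ℝ) : ℂ) * r) = ((φ t : ℝ) : ℂ) := fun t => by
    have hmem := coe_mul_mem_disk t hrd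
    have hev : lift α logHol =ᶠ[nhds (((t : ℝ) : ℂ) * r)] logKernel α 1 0 :=
      Filter.eventuallyEq_of_mem (disk_mem_nhds hmem) fun w hw => by
        rw [lift, logKernel, logHol_apply hw]
        push_cast
        ring
    rw [hev.iteratedDeriv_eq, hab _ hmem, ← Complex.ofReal_mul, logKernel_ofReal _ _ _ (htr t)]
    rw [hφ]
    push_cast
    ring
  have hint : Integrable φ μ := by
    have h := integrable_dilation μ j
      (differentiableOn_iteratedDeriv (differentiableOn_lift α logHol) j).continuousOn hrd
    simp_rw [heq] at h
    exact h.re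
  rw [iteratedDeriv_cesaroIntegral μ α logHol j hrd]
  simp_rw [heq]
  rw [integral_complex_ofReal, Complex.norm_real]
  refine le_trans ?_ (mul_le_mul_of_nonneg_left (le_abs_self _) (by positivity))
  rw [moment, ← integral_const_mul, ← integral_const_mul]
  refine integral_mono ((integrable_coe_pow μ _).const_mul _) (hint.const_mul _) fun t => ?_
  have hy : 0 < 1 - (t : ℝ) * r := by linarith [htr t]
  have htj : 0 ≤ (t : ℝ) ^ j := pow_nonneg t.2.1 j
  calc _ ≤ C * ((t : ℝ) ^ j * ((1 - t * r) ^ (-(α + j)) * (1 - Real.log (1 - t * r)))) :=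
        hk m hm t t.2.1 t.2.2
    _ = C / a * ((t : ℝ) ^ j * ((1 - t * r) ^ (-(α + j)) *
        (a * (1 - Real.log (1 - t * r)) + 0))) := by
      field_simp
      ring
    _ ≤ C / a * ((t : ℝ) ^ j * ((1 - t * r) ^ (-(α + j)) *
        (a * (1 - Real.log (1 - t * r)) + b))) := by gcongr

/-! ### The Besov integral in terms of one derivative -/

/-- The order of the derivative in the Besov norm. -/
def besovOrder (p : ℝ) : ℕ := if p = 1 then 2 else 1

lemma one_le_besovOrder (p : ℝ) : 1 ≤ besovOrder p := by
  unfold besovOrder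
  split_ifs <;> norm_num

lemma one_lt_besovOrder_mul {p : ℝ} (hp : 1 ≤ p) : 1 < besovOrder p * p := by
  unfold besovOrder
  split_ifs with h
  · rw [h]
    norm_num
  · simpa using lt_of_le_of_ne hp (Ne.symm h)

/-- Unifies the two definitions: at `p = 1`, `j = 2` the weight exponent `jp - 2` vanishes, and at
`j = 1` it is `p - 2`. -/
lemma besovIntegral_eq (p : ℝ) (f : ℂ → ℂ) :
    besovIntegral p f = (∫⁻ z, ‖iteratedDeriv (besovOrder p) f z‖ₑ ^ p *
      ENNReal.ofReal ((1 - ‖z‖) ^ (besovOrder p * p - 2)) ∂area) ^ (1 / p) := by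
  unfold besovIntegral besovOrder
  split_ifs with h
  · subst h
    have h2 : iteratedDeriv 2 f = deriv (deriv f) := by
      rw [iteratedDeriv_succ, iteratedDeriv_one]
    simp [h2]
  · simp [iteratedDeriv_one]

lemma measurable_iteratedDeriv (f : ℂ → ℂ) {j : ℕ} (hj : 1 ≤ j) :
    Measurable (iteratedDeriv j f) := by
  obtain ⟨i, rfl⟩ := Nat.exists_eq_add_of_le' hj
  rw [iteratedDeriv_succ]
  exact measurable_deriv _

lemma iteratedDeriv_congr_on_disk {f g : ℂ → ℂ} (h : ∀ z ∈ disk, f z = g z) (j : ℕ) {z : ℂ}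
    (hz : z ∈ disk) : iteratedDeriv j f z = iteratedDeriv j g z :=
  Filter.EventuallyEq.iteratedDeriv_eq j (Filter.eventuallyEq_of_mem (disk_mem_nhds hz) h)

lemma summable_condensed_of_besovIntegral_lt_top {α p : ℝ} (hα : 0 < α) (hp : 1 ≤ p) (g : Hol)
    (hg : ∀ z ∈ disk, g z = cesaroIntegral μ α logHol z) (hfin : besovIntegral p g < ∞) :
    Summable fun m : ℕ => (2 : ℝ) ^ (m * (α * p)) * (m + 1) ^ p * moment μ (2 ^ m) ^ p := by
  have hp0 : 0 < p := by linarith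
  set j := besovOrder p with hj
  rw [besovIntegral_eq, ENNReal.rpow_lt_top_iff_of_pos (by positivity)] at hfin
  have hs := summable_norm_rpow_of_lintegral_lt_top hp
    (measurable_iteratedDeriv g (one_le_besovOrder p)) (differentiableOn_iteratedDeriv g.2.1 _) hfin
  obtain ⟨C, hC, hk⟩ := exists_moment_le_norm_iteratedDeriv μ hα j
  -- Discards finitely many terms, so that the remaining indices satisfy `2j ≤ 2^n`.
  rw [← summable_nat_add_iff (2 * j)] at hs ⊢
  refine Summable.of_nonneg_of_le (fun m => ?_) (fun m => ?_) (hs.mul_left (C ^ p))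
  · have := moment_nonneg μ (2 ^ (m + 2 * j))
    positivity
  generalize hn : m + 2 * j = n
  have hmom := moment_nonneg μ (2 ^ n)
  have hjn : 2 * j ≤ 2 ^ n := by
    have : n < 2 ^ n := Nat.lt_two_pow_self
    omega
  have hrd : ((1 - (1 / 2) ^ n : ℝ) : ℂ) ∈ disk := by
    have hd0 : (0 : ℝ) < (1 / 2) ^ n := by positivity
    have hd1 : (1 / 2 : ℝ) ^ n ≤ 1 := pow_le_one₀ (by norm_num) (by norm_num)
    rw [mem_disk, Complex.norm_real, Real.norm_eq_abs, abs_of_nonneg (by linarith)]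
    linarith
  rw [iteratedDeriv_congr_on_disk hg _ hrd]
  have h1 := Real.rpow_le_rpow (by positivity) (hk n hjn) hp0.le
  rw [Real.mul_rpow (by positivity) hmom, Real.mul_rpow (by positivity) (by positivity),
    Real.mul_rpow hC.le (norm_nonneg _), ← Real.rpow_mul (by norm_num)] at h1
  have e1 : (2 : ℝ) ^ (n * (α * p)) = 2 ^ (-(n * (j * p - 2 + 2))) * 2 ^ (n * (α + j) * p) := by
    rw [← Real.rpow_add (by norm_num)]
    ring_nf
  rw [e1]
  calc _ = 2 ^ (-(n * (j * p - 2 + 2))) *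
        (2 ^ (n * (α + j) * p) * ((n : ℝ) + 1) ^ p * moment μ (2 ^ n) ^ p) := by ring
    _ ≤ 2 ^ (-(n * (j * p - 2 + 2))) * (C ^ p * ‖iteratedDeriv j (cesaroIntegral μ α logHol)
        ((1 - (1 / 2) ^ n : ℝ) : ℂ)‖ ^ p) := by gcongr
    _ = _ := by ring

end

open Filter
open scoped Topology

/-! ### Bounded pointwise convergence of holomorphic functions -/

/-- Pointwise convergence in the disk of a sequence of holomorphic functions that is bounded on
every smaller disk. -/
structure NormalConvergence (h : ℕ → ℂ → ℂ) (g : ℂ → ℂ) : Prop where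
  differentiableOn : ∀ n, DifferentiableOn ℂ (h n) disk
  differentiableOn_lim : DifferentiableOn ℂ g disk
  bounded : ∀ ρ < 1, ∃ C, ∀ n w, ‖w‖ ≤ ρ → ‖h n w‖ ≤ C
  tendsto : ∀ z ∈ disk, Tendsto (fun n => h n z) atTop (𝓝 (g z))

/-- Local bounds follow from Cauchy's estimate on a slightly larger disk, convergence from Cauchy's
formula for the derivative and dominated convergence on the circle. -/
lemma NormalConvergence.deriv {h : ℕ → ℂ → ℂ} {g : ℂ → ℂ} (H : NormalConvergence h g) :
    NormalConvergence (fun n => deriv (h n)) (deriv g) where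
  differentiableOn n := (H.differentiableOn n).deriv Metric.isOpen_ball
  differentiableOn_lim := H.differentiableOn_lim.deriv Metric.isOpen_ball
  bounded ρ hρ := by
    obtain ⟨r, hρr, hr⟩ := exists_between hρ
    obtain ⟨C, hC⟩ := H.bounded r hr
    refine ⟨C / (r - ρ), fun n w hw => ?_⟩
    have hle : ∀ u ∈ Metric.closedBall w (r - ρ), ‖u‖ ≤ r := fun u hu => by
      rw [mem_closedBall_iff_norm] at hu
      linarith [norm_le_norm_add_norm_sub' u w]
    refine Complex.norm_deriv_le_of_forall_mem_sphere_norm_le (by linarith)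
      ((H.differentiableOn n).diffContOnCl_ball fun u hu => mem_disk.2 ((hle u hu).trans_lt hr))
      fun u hu => hC n u (hle u (Metric.sphere_subset_closedBall hu))
  tendsto z hz := by
    obtain ⟨ρ, hzρ, hρ⟩ := exists_between (mem_disk.1 hz)
    obtain ⟨C, hC⟩ := H.bounded ρ hρ
    have hρ0 : 0 < ρ := (norm_nonneg z).trans_lt hzρ
    have hsub : Metric.closedBall (0 : ℂ) ρ ⊆ disk := Metric.closedBall_subset_ball hρ
    have hmem : ∀ θ, circleMap 0 ρ θ ∈ disk := fun θ =>
      hsub (Metric.sphere_subset_closedBall (circleMap_mem_sphere 0 hρ0.le θ))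
    have hne : ∀ θ, circleMap 0 ρ θ - z ≠ 0 := fun θ h0 => by
      have h1 : ‖circleMap 0 ρ θ‖ = ρ := by simp [abs_of_pos hρ0]
      rw [sub_eq_zero.1 h0] at h1
      linarith
    have hrep : ∀ f : ℂ → ℂ, DifferentiableOn ℂ f disk →
        (2 * ↑Real.pi * Complex.I)⁻¹ • ∮ w in C(0, ρ), ((w - z) ^ 2)⁻¹ • f w = _root_.deriv f z :=
      fun f hf => Complex.two_pi_I_inv_smul_circleIntegral_sub_sq_inv_smul_of_differentiable
        Metric.isOpen_ball hsub hf (mem_ball_zero_iff.2 hzρ)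
    have hcont : ∀ f : ℂ → ℂ, DifferentiableOn ℂ f disk → Continuous fun θ : ℝ =>
        _root_.deriv (circleMap 0 ρ) θ • ((circleMap 0 ρ θ - z) ^ 2)⁻¹ • f (circleMap 0 ρ θ) :=
      fun f hf => by
        have h1 := hf.continuousOn.comp_continuous (continuous_circleMap 0 ρ) hmem
        have h2 : Continuous fun θ : ℝ => ((circleMap 0 ρ θ - z) ^ 2)⁻¹ :=
          (((continuous_circleMap 0 ρ).sub continuous_const).pow 2).inv₀
            fun θ => pow_ne_zero 2 (hne θ)
        simp only [deriv_circleMap]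
        exact ((continuous_circleMap 0 ρ).mul continuous_const).smul (h2.smul h1)
    rw [← hrep g H.differentiableOn_lim]
    simp_rw [← hrep _ (H.differentiableOn _)]
    refine Tendsto.const_smul ?_ _
    simp only [circleIntegral]
    refine intervalIntegral.tendsto_integral_filter_of_dominated_convergence
      (fun θ => ‖_root_.deriv (circleMap 0 ρ) θ‖ * (‖((circleMap 0 ρ θ - z) ^ 2)⁻¹‖ * C))
      (Eventually.of_forall fun n => (hcont _ (H.differentiableOn n)).aestronglyMeasurable)
      (Eventually.of_forall fun n => ae_of_all _ fun θ _ => ?_) ?_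
      (ae_of_all _ fun θ _ => ((H.tendsto _ (hmem θ)).const_smul _).const_smul _)
    · rw [norm_smul, norm_smul]
      gcongr
      exact hC n _ (by simp [abs_of_pos hρ0])
    · have h1 := (hcont (fun _ => 1) (differentiableOn_const _)).norm
      simp only [norm_smul, norm_one, mul_one] at h1
      refine ((h1.mul_const C).congr fun θ => ?_).intervalIntegrable _ _
      rw [mul_assoc]

lemma NormalConvergence.iteratedDeriv {h : ℕ → ℂ → ℂ} {g : ℂ → ℂ} (H : NormalConvergence h g)
    (j : ℕ) : NormalConvergence (fun n => iteratedDeriv j (h n)) (iteratedDeriv j g) := by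
  induction j with
  | zero => simpa using H
  | succ j ih =>
    simp only [iteratedDeriv_succ]
    exact ih.deriv

/-! ### Sequential compactness of balls of the Bloch space -/

lemma norm_le_of_mem_blochBall_of_norm_le {M ρ : ℝ} {f : Hol} (hf : f ∈ blochBall M) (hρ : ρ < 1)
    {w : ℂ} (hw : ‖w‖ ≤ ρ) : ‖f w‖ ≤ M * (1 - Real.log (1 - ρ)) := by
  refine (norm_le_of_mem_blochBall hf (mem_disk.2 (hw.trans_lt hρ))).trans ?_
  have := blochBall_nonneg hf
  have h1 : 0 < 1 - ρ := by linarith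
  gcongr

lemma norm_taylorCoeff_le {M : ℝ} {f : Hol} (hf : f ∈ blochBall M) {r : ℝ} (hr0 : 0 < r)
    (hr : r < 1) (k : ℕ) : ‖taylorCoeff f k‖ ≤ M * (1 - Real.log (1 - r)) / r ^ k := by
  have h := Complex.norm_iteratedDeriv_le_of_forall_mem_sphere_norm_le (f := f) (c := 0) k hr0
    (f.2.1.diffContOnCl_ball (Metric.closedBall_subset_ball hr))
    fun w hw => norm_le_of_mem_blochBall_of_norm_le hf hr (mem_sphere_zero_iff_norm.1 hw).le
  have hk : (0 : ℝ) < k.factorial := by positivity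
  rw [taylorCoeff, norm_div, Complex.norm_natCast, div_le_iff₀ hk]
  refine h.trans_eq ?_
  ring

open Classical in
-- Montel's theorem through Taylor coefficients: the coefficient sequences lie in a product of
-- compact disks, so a subsequence converges coefficientwise. The Cauchy bounds at every radius `r <
-- 1` pass to the limit; they make the limit series holomorphic in the disk and dominate the partial
-- series.
lemma exists_subseq_normalConvergence {M : ℝ} (f : ℕ → Hol) (hf : ∀ n, f n ∈ blochBall M) :
    ∃ g ∈ blochBall M, ∃ φ : ℕ → ℕ, StrictMono φ ∧ NormalConvergence (fun n => f (φ n)) g := by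
  set B : ℝ → ℝ := fun r => M * (1 - Real.log (1 - r)) with hB
  -- Radius `1/2` is an arbitrary choice that suffices for compactness; `hale` recovers the bounds
  -- at all radii.
  have hcomp : IsCompact (Set.univ.pi fun k : ℕ => Metric.closedBall (0 : ℂ) (B 2⁻¹ / 2⁻¹ ^ k)) :=
    isCompact_univ_pi fun k => isCompact_closedBall _ _
  obtain ⟨a, -, φ, hφ, ha⟩ := hcomp.tendsto_subseq (x := fun n k => taylorCoeff (f n) k)
    fun n k _ => mem_closedBall_zero_iff.2
      (norm_taylorCoeff_le (hf n) (by norm_num) (by norm_num) k)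
  have ha' : ∀ k, Tendsto (fun n => taylorCoeff (f (φ n)) k) atTop (𝓝 (a k)) :=
    fun k => (tendsto_pi_nhds.1 ha) k
  have hale : ∀ r, 0 < r → r < 1 → ∀ k, ‖a k‖ ≤ B r / r ^ k := fun r hr0 hr k =>
    le_of_tendsto (ha' k).norm (Eventually.of_forall fun n =>
      norm_taylorCoeff_le (hf (φ n)) hr0 hr k)
  have hterm : ∀ r, 0 < r → ∀ ρ, ∀ w : ℂ, ‖w‖ ≤ ρ → ∀ k (c : ℂ), ‖c‖ ≤ B r / r ^ k →
      ‖c * w ^ k‖ ≤ B r * (ρ / r) ^ k := fun r hr0 ρ w hw k c hc => by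
    rw [norm_mul, norm_pow]
    calc _ ≤ B r / r ^ k * ρ ^ k := by
          gcongr
          exact (norm_nonneg _).trans hc
      _ = _ := by rw [div_pow]; ring
  have hsummable : ∀ r ρ, 0 ≤ ρ → ρ < r → Summable fun k : ℕ => B r * (ρ / r) ^ k :=
    fun r ρ hρ0 hρ => (summable_geometric_of_lt_one (div_nonneg hρ0 (hρ0.trans hρ.le))
      ((div_lt_one (hρ0.trans_lt hρ)).2 hρ)).mul_left _
  set G : ℂ → ℂ := fun z => ∑' k, a k * z ^ k with hG
  have hGd : DifferentiableOn ℂ G disk := fun z hz => by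
    obtain ⟨ρ, hzρ, hρ⟩ := exists_between (mem_disk.1 hz)
    obtain ⟨r, hρr, hr⟩ := exists_between hρ
    have hρ0 : 0 < ρ := (norm_nonneg z).trans_lt hzρ
    have hd := Complex.differentiableOn_tsum_of_summable_norm (U := Metric.ball (0 : ℂ) ρ)
      (F := fun k w => a k * w ^ k) (hsummable r ρ hρ0.le hρr) (fun k => by fun_prop)
      Metric.isOpen_ball fun k w hw => hterm r (hρ0.trans hρr) ρ w (mem_ball_zero_iff.1 hw).le k _
        (hale r (hρ0.trans hρr) hr k)
    exact (hd.differentiableAt (Metric.isOpen_ball.mem_nhds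
      (mem_ball_zero_iff.2 hzρ))).differentiableWithinAt
  let g : Hol := ⟨fun z => if z ∈ disk then G z else 0,
    hGd.congr fun z hz => if_pos hz, fun z hz => if_neg hz⟩
  have hconv : NormalConvergence (fun n => f (φ n)) g := by
    refine ⟨fun n => (f (φ n)).2.1, g.2.1, fun ρ hρ => ⟨_, fun n w hw =>
      norm_le_of_mem_blochBall_of_norm_le (hf (φ n)) hρ hw⟩, fun z hz => ?_⟩
    obtain ⟨r, hzr, hr⟩ := exists_between (mem_disk.1 hz)
    have hr0 : 0 < r := (norm_nonneg z).trans_lt hzr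
    have hgz : g z = G z := if_pos hz
    rw [hgz]
    simp_rw [← fun n => (hasSum_taylorCoeff (f (φ n)) hz).tsum_eq]
    exact tendsto_tsum_of_dominated_convergence (hsummable r ‖z‖ (norm_nonneg z) hzr)
      (fun k => (ha' k).mul_const _) (Eventually.of_forall fun n k =>
        hterm r hr0 ‖z‖ z le_rfl k _ (norm_taylorCoeff_le (hf (φ n)) hr0 hr k))
  refine ⟨g, ⟨le_of_tendsto (hconv.tendsto 0 zero_mem_disk).norm
    (Eventually.of_forall fun n => (hf (φ n)).1), fun z hz => ?_⟩, φ, hφ, hconv⟩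
  exact le_of_tendsto ((hconv.deriv.tendsto z hz).norm.const_mul _)
    (Eventually.of_forall fun n => (hf (φ n)).2 z hz)

/-- The weighted integral of the `p`-th power of the majorant. -/
def majorantIntegral (μ : Measure (Set.Ico (0 : ℝ) 1)) (α p : ℝ) : ℝ≥0∞ :=
  ∫⁻ z, ENNReal.ofReal (majorant μ α (besovOrder p) z) ^ p *
    ENNReal.ofReal ((1 - ‖z‖) ^ (besovOrder p * p - 2)) ∂area

lemma lintegral_const_majorant_lt_top (μ : Measure (Set.Ico (0 : ℝ) 1)) {α p : ℝ} (hp : 1 ≤ p)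
    (hmaj : majorantIntegral μ α p < ∞) {A : ℝ} (hA : 0 ≤ A) :
    ∫⁻ z, ENNReal.ofReal (A * majorant μ α (besovOrder p) z) ^ p *
      ENNReal.ofReal ((1 - ‖z‖) ^ (besovOrder p * p - 2)) ∂area < ∞ := by
  have hp0 : 0 ≤ p := by linarith
  have h : ∀ z, ENNReal.ofReal (A * majorant μ α (besovOrder p) z) ^ p *
      ENNReal.ofReal ((1 - ‖z‖) ^ (besovOrder p * p - 2)) = ENNReal.ofReal A ^ p *
      (ENNReal.ofReal (majorant μ α (besovOrder p) z) ^ p *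
        ENNReal.ofReal ((1 - ‖z‖) ^ (besovOrder p * p - 2))) := fun z => by
    rw [ENNReal.ofReal_mul hA, ENNReal.mul_rpow_of_nonneg _ _ hp0, mul_assoc]
  have ht : ENNReal.ofReal A ^ p ≠ ∞ := ENNReal.rpow_ne_top_of_nonneg hp0 ENNReal.ofReal_ne_top
  simp_rw [h]
  rw [lintegral_const_mul' _ _ ht]
  exact ENNReal.mul_lt_top ht.lt_top hmaj

section

variable (μ : Measure (Set.Ico (0 : ℝ) 1)) [IsFiniteMeasure μ]

/-! ### Stability of normal convergence under the operator. -/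

lemma NormalConvergence.cesaroIntegral (α : ℝ) {M : ℝ} {f : ℕ → Hol} {g : Hol}
    (hf : ∀ n, f n ∈ blochBall M) (H : NormalConvergence (fun n => f n) g) :
    NormalConvergence (fun n => cesaroIntegral μ α (f n)) (cesaroIntegral μ α g) := by
  have hlift : ∀ ρ < 1, ∃ C, ∀ n w, ‖w‖ ≤ ρ → ‖lift α (f n) w‖ ≤ C := fun ρ hρ => by
    obtain ⟨C, hC⟩ := exists_norm_le_of_continuousOn (differentiableOn_powKernel α).continuousOn hρ
    refine ⟨M * (1 - Real.log (1 - ρ)) * C, fun n w hw => ?_⟩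
    have h1 := norm_le_of_mem_blochBall_of_norm_le (hf n) hρ hw
    rw [lift, norm_mul]
    exact mul_le_mul h1 (hC w hw) (norm_nonneg _) ((norm_nonneg _).trans h1)
  have hint : ∀ (u : Hol) {z : ℂ}, z ∈ disk →
      Integrable (fun t : Set.Ico (0 : ℝ) 1 => lift α u (((t : ℝ) : ℂ) * z)) μ := fun u z hz => by
    simpa using integrable_dilation μ 0 (differentiableOn_lift α u).continuousOn hz
  refine ⟨fun n => differentiableOn_cesaroIntegral μ α _, differentiableOn_cesaroIntegral μ α _,
    fun ρ hρ => ?_, fun z hz => ?_⟩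
  · obtain ⟨C, hC⟩ := hlift ρ hρ
    refine ⟨C * μ.real Set.univ, fun n w hw => ?_⟩
    exact norm_integral_le_of_norm_le_const (ae_of_all _ fun t =>
      hC n _ ((norm_coe_mul_le t w).trans hw))
  · obtain ⟨C, hC⟩ := hlift ‖z‖ (mem_disk.1 hz)
    refine tendsto_integral_of_dominated_convergence (fun _ => C)
      (fun n => (hint _ hz).aestronglyMeasurable) (integrable_const _)
      (fun n => ae_of_all _ fun t => hC n _ (norm_coe_mul_le t z)) (ae_of_all _ fun t => ?_)
    exact (H.tendsto _ (coe_mul_mem_disk t hz)).mul_const _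

/-! ### The operator with values in the Besov space -/

open Classical in
/-- The Cesàro-like operator as a linear map of `H(𝔻)`. -/
def cesaroHol (α : ℝ) : Hol →ₗ[ℂ] Hol where
  toFun f := ⟨fun z => if z ∈ disk then cesaroIntegral μ α f z else 0,
    (differentiableOn_cesaroIntegral μ α f).congr fun z hz => if_pos hz, fun z hz => if_neg hz⟩
  map_add' f g := by
    apply Subtype.ext
    funext z
    by_cases hz : z ∈ disk
    · have hint : ∀ u : Hol,
          Integrable (fun t : Set.Ico (0 : ℝ) 1 => lift α u (((t : ℝ) : ℂ) * z)) μ := fun u => by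
        simpa using integrable_dilation μ 0 (differentiableOn_lift α u).continuousOn hz
      have h : cesaroIntegral μ α (f + g) z = cesaroIntegral μ α f z + cesaroIntegral μ α g z := by
        simp only [cesaroIntegral]
        rw [← integral_add (hint f) (hint g)]
        congr 1
        funext t
        exact add_mul _ _ _
      simp [mem_disk.1 hz, h]
    · simp [mt mem_disk.2 hz]
  map_smul' c f := by
    apply Subtype.ext
    funext z
    by_cases hz : z ∈ disk
    · have h : cesaroIntegral μ α (c • f) z = c * cesaroIntegral μ α f z := by
        simp only [cesaroIntegral]
        rw [← integral_const_mul]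
        congr 1
        funext t
        exact mul_assoc _ _ _
      simp [mem_disk.1 hz, h]
    · simp [mt mem_disk.2 hz]

lemma cesaroHol_apply (α : ℝ) (f : Hol) {z : ℂ} (hz : z ∈ disk) :
    cesaroHol μ α f z = cesaroIntegral μ α f z := if_pos hz

lemma besovIntegral_cesaroHol_lt_top {α p : ℝ} (hα : 0 < α) (hp : 1 ≤ p)
    (hmaj : majorantIntegral μ α p < ∞) {M : ℝ} {f : Hol} (hf : f ∈ blochBall M) :
    besovIntegral p (cesaroHol μ α f) < ∞ := by
  have hp0 : 0 < p := by linarith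
  obtain ⟨C, hC, hle⟩ := exists_norm_iteratedDeriv_le_majorant μ hα (besovOrder p)
  rw [besovIntegral_eq, ENNReal.rpow_lt_top_iff_of_pos (by positivity)]
  refine lt_of_le_of_lt (lintegral_mono_ae ?_)
    (lintegral_const_majorant_lt_top μ hp hmaj (mul_nonneg hC (blochBall_nonneg hf)))
  filter_upwards [ae_area_mem] with z hz
  rw [iteratedDeriv_congr_on_disk (fun w hw => cesaroHol_apply μ α f hw) _ hz, ← ofReal_norm]
  gcongr
  exact hle M f hf z hz

/-- Normal convergence gives pointwise convergence of the `j`-th derivatives, and twice the common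
majorant, scaled by `CM`, dominates all the differences. -/
lemma tendsto_besovIntegral_sub {α p : ℝ} (hα : 0 < α) (hp : 1 ≤ p)
    (hmaj : majorantIntegral μ α p < ∞) {M : ℝ} {f : ℕ → Hol} {g : Hol}
    (hf : ∀ n, f n ∈ blochBall M) (hg : g ∈ blochBall M)
    (H : NormalConvergence (fun n => f n) g) :
    Tendsto (fun n => besovIntegral p (cesaroHol μ α (f n) - cesaroHol μ α g : Hol)) atTop
      (𝓝 0) := by
  have hp0 : 0 < p := by linarith
  obtain ⟨C, hC, hle⟩ := exists_norm_iteratedDeriv_le_majorant μ hα (besovOrder p)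
  set j := besovOrder p with hj
  have hM := blochBall_nonneg hg
  have hconv := (H.cesaroIntegral μ α hf).iteratedDeriv j
  have hder : ∀ n, ∀ z ∈ disk, iteratedDeriv j (cesaroHol μ α (f n) - cesaroHol μ α g : Hol) z =
      iteratedDeriv j (cesaroIntegral μ α (f n)) z - iteratedDeriv j (cesaroIntegral μ α g) z :=
    fun n z hz => by
      have hcd : ∀ u : Hol, ContDiffAt ℂ j (cesaroIntegral μ α u) z := fun u =>
        ((differentiableOn_cesaroIntegral μ α u).contDiffOn Metric.isOpen_ball).contDiffAt
          (disk_mem_nhds hz)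
      rw [← iteratedDeriv_sub (hcd _) (hcd _)]
      refine iteratedDeriv_congr_on_disk (fun w hw => ?_) _ hz
      rw [Pi.sub_apply, ← cesaroHol_apply μ α _ hw, ← cesaroHol_apply μ α _ hw]
      rfl
  have key : Tendsto (fun n => ∫⁻ z,
      ‖iteratedDeriv j (cesaroHol μ α (f n) - cesaroHol μ α g : Hol) z‖ₑ ^ p *
      ENNReal.ofReal ((1 - ‖z‖) ^ (j * p - 2)) ∂area) atTop (𝓝 (∫⁻ _, 0 ∂area)) := by
    refine tendsto_lintegral_of_dominated_convergence
      (fun z => ENNReal.ofReal (2 * (C * M) * majorant μ α j z) ^ p *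
        ENNReal.ofReal ((1 - ‖z‖) ^ (j * p - 2))) (fun n => ?_) (fun n => ?_)
      (lintegral_const_majorant_lt_top μ hp hmaj (by positivity)).ne ?_
    · exact ((measurable_iteratedDeriv _ (one_le_besovOrder p)).enorm.pow_const p).mul
        (by fun_prop)
    · filter_upwards [ae_area_mem] with z hz
      rw [hder n z hz, ← ofReal_norm]
      gcongr
      have h1 := hle M _ (hf n) z hz
      have h2 := hle M _ hg z hz
      linarith [norm_sub_le (iteratedDeriv j (cesaroIntegral μ α (f n)) z)
        (iteratedDeriv j (cesaroIntegral μ α g) z)]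
    · filter_upwards [ae_area_mem] with z hz
      have h1 : Tendsto (fun n => ‖iteratedDeriv j (cesaroHol μ α (f n) - cesaroHol μ α g : Hol)
          z‖ₑ) atTop (𝓝 0) := by
        simp_rw [hder _ z hz]
        have h2 := ((hconv.tendsto z hz).sub_const (iteratedDeriv j (cesaroIntegral μ α g) z)).enorm
        simpa using h2
      have h3 := (h1.ennrpow_const p)
      rw [ENNReal.zero_rpow_of_pos hp0] at h3
      have h4 := ENNReal.Tendsto.mul_const h3 (b := ENNReal.ofReal ((1 - ‖z‖) ^ (j * p - 2)))
        (Or.inr ENNReal.ofReal_ne_top)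
      simpa using h4
  rw [lintegral_zero] at key
  have h := key.ennrpow_const (1 / p)
  rw [ENNReal.zero_rpow_of_pos (by positivity)] at h
  simp_rw [besovIntegral_eq]
  exact h

lemma tendsto_besovNorm_sub {α p : ℝ} (hα : 0 < α) (hp : 1 ≤ p)
    (hmaj : majorantIntegral μ α p < ∞) {M : ℝ} {f : ℕ → Hol} {g : Hol}
    (hf : ∀ n, f n ∈ blochBall M) (hg : g ∈ blochBall M)
    (H : NormalConvergence (fun n => f n) g) :
    Tendsto (fun n => besovNorm p (cesaroHol μ α (f n) - cesaroHol μ α g : Hol)) atTop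
      (𝓝 0) := by
  have hconv := H.cesaroIntegral μ α hf
  have hval : ∀ n, ∀ z ∈ disk, (cesaroHol μ α (f n) - cesaroHol μ α g : Hol) z =
      cesaroIntegral μ α (f n) z - cesaroIntegral μ α g z := fun n z hz => by
    rw [← cesaroHol_apply μ α _ hz, ← cesaroHol_apply μ α _ hz]
    rfl
  have h0 : Tendsto (fun n => ‖(cesaroHol μ α (f n) - cesaroHol μ α g : Hol) 0‖) atTop (𝓝 0) := by
    simp_rw [hval _ 0 zero_mem_disk]
    have h := ((hconv.tendsto 0 zero_mem_disk).sub_const (cesaroIntegral μ α g 0)).norm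
    simpa using h
  have h1 : Tendsto (fun n => if p = 1 then
      ‖deriv (cesaroHol μ α (f n) - cesaroHol μ α g : Hol) 0‖ else 0) atTop (𝓝 0) := by
    split_ifs
    · have hd : ∀ n, deriv (cesaroHol μ α (f n) - cesaroHol μ α g : Hol) 0 =
          deriv (cesaroIntegral μ α (f n)) 0 - deriv (cesaroIntegral μ α g) 0 := fun n => by
        have hda : ∀ u : Hol, DifferentiableAt ℂ (cesaroIntegral μ α u) 0 := fun u =>
          (differentiableOn_cesaroIntegral μ α u).differentiableAt (disk_mem_nhds zero_mem_disk)
        rw [← deriv_sub (hda _) (hda _)]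
        exact EventuallyEq.deriv_eq
          (eventuallyEq_of_mem (disk_mem_nhds zero_mem_disk) fun w hw => hval n w hw)
      simp_rw [hd]
      have h := ((hconv.deriv.tendsto 0 zero_mem_disk).sub_const
        (deriv (cesaroIntegral μ α g) 0)).norm
      simpa using h
    · exact tendsto_const_nhds
  have h2 := (ENNReal.tendsto_toReal ENNReal.zero_ne_top).comp
    (tendsto_besovIntegral_sub μ hα hp hmaj hf hg H)
  have h := (h0.add h1).add h2
  simpa [besovNorm] using h

end

/-! ### Bounded inclusion in the Bloch space -/

lemma exists_mem_blochBall_of_mem_bloch {f : Hol} (hf : f ∈ bloch) : ∃ M, f ∈ blochBall M := by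
  obtain ⟨C, hC⟩ := hf
  exact ⟨max ‖f 0‖ C, le_max_left _ _, fun z hz => (hC z hz).trans (le_max_right _ _)⟩

lemma exists_norm_deriv_le {X : Type*} [NormedAddCommGroup X] [NormedSpace ℂ X]
    {ι : X →ₗ[ℂ] Hol} (hι : IsAnalyticFunctionSpace ι) {z : ℂ} (hz : z ∈ disk) :
    ∃ C, ∀ x, ‖deriv (ι x) z‖ ≤ C * ‖x‖ := by
  have hz1 := mem_disk.1 hz
  set r := (1 - ‖z‖) / 2 with hr
  have hr0 : 0 < r := by linarith
  have hsub : Metric.closedBall z r ⊆ disk := fun w hw => by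
    rw [mem_closedBall_iff_norm] at hw
    rw [mem_disk]
    linarith [norm_le_norm_add_norm_sub' w z]
  obtain ⟨C, hC⟩ := hι.2 _ (isCompact_closedBall z r) hsub
  refine ⟨C / r, fun x => ?_⟩
  refine (Complex.norm_deriv_le_of_forall_mem_sphere_norm_le hr0
    ((ι x).2.1.diffContOnCl_ball hsub)
    fun w hw => hC x w (Metric.sphere_subset_closedBall hw)).trans_eq ?_
  ring

/-- Evaluation of the derivative at a point of the disk as a functional on `X`. -/
lemma exists_derivCLM {X : Type*} [NormedAddCommGroup X] [NormedSpace ℂ X]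
    {ι : X →ₗ[ℂ] Hol} (hι : IsAnalyticFunctionSpace ι) {z : ℂ} (hz : z ∈ disk) :
    ∃ L : X →L[ℂ] ℂ, ∀ x, L x = ((1 - ‖z‖ ^ 2 : ℝ) : ℂ) * deriv (ι x) z := by
  obtain ⟨C, hC⟩ := exists_norm_deriv_le hι hz
  let L : X →ₗ[ℂ] ℂ :=
    { toFun := fun x => ((1 - ‖z‖ ^ 2 : ℝ) : ℂ) * deriv (ι x) z
      map_add' := fun x y => by rw [map_add, Hol.deriv_add _ _ hz, mul_add]
      map_smul' := fun c x => by
        rw [map_smul, Hol.deriv_smul]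
        simp only [Pi.smul_apply, smul_eq_mul, RingHom.id_apply]
        ring }
  refine ⟨L.mkContinuous (‖((1 - ‖z‖ ^ 2 : ℝ) : ℂ)‖ * C) fun x => ?_, fun x => rfl⟩
  change ‖((1 - ‖z‖ ^ 2 : ℝ) : ℂ) * deriv (ι x) z‖ ≤ _
  rw [norm_mul, mul_assoc]
  gcongr
  exact hC x

/-- The functionals `x ↦ (1 - |z|²) (ι x)'(z)` are continuous by Cauchy's estimate and pointwise
bounded because `X` lies in the Bloch space. Banach–Steinhaus makes them uniformly bounded;
completeness of `X` enters here. -/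
lemma exists_forall_mem_blochBall {X : Type*} [NormedAddCommGroup X] [NormedSpace ℂ X]
    [CompleteSpace X] {ι : X →ₗ[ℂ] Hol} (hι : IsAnalyticFunctionSpace ι)
    (hB : Set.range ι ⊆ bloch) : ∃ M, ∀ x, ‖x‖ ≤ 1 → ι x ∈ blochBall M := by
  choose L hL using fun z : disk => exists_derivCLM hι z.2
  have hw : ∀ z ∈ disk, 0 ≤ 1 - ‖z‖ ^ 2 := fun z hz => by
    nlinarith [mem_disk.1 hz, norm_nonneg z]
  have hnorm : ∀ (z : disk) (x : X), ‖L z x‖ = (1 - ‖z.1‖ ^ 2) * ‖deriv (ι x) z‖ := fun z x => by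
    rw [hL, norm_mul, Complex.norm_real, Real.norm_eq_abs, abs_of_nonneg (hw z z.2)]
  obtain ⟨C, hC⟩ := banach_steinhaus (g := L) fun x => by
    obtain ⟨M, hM⟩ := hB ⟨x, rfl⟩
    exact ⟨M, fun z => (hnorm z x).trans_le (hM z z.2)⟩
  obtain ⟨C₀, hC₀⟩ := hι.2 {0} isCompact_singleton (by simp)
  refine ⟨max |C₀| C, fun x hx => ⟨?_, fun z hz => ?_⟩⟩
  · refine le_trans ?_ (le_max_left _ _)
    calc _ ≤ C₀ * ‖x‖ := hC₀ x 0 rfl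
      _ ≤ |C₀| * 1 := mul_le_mul (le_abs_self _) hx (norm_nonneg _) (abs_nonneg _)
      _ = _ := mul_one _
  · refine le_trans ?_ (le_max_right _ _)
    rw [← hnorm ⟨z, hz⟩ x]
    calc _ ≤ ‖L ⟨z, hz⟩‖ * ‖x‖ := (L ⟨z, hz⟩).le_opNorm x
      _ ≤ ‖L ⟨z, hz⟩‖ * 1 := by gcongr
      _ ≤ C := (mul_one _).trans_le (hC _)

/-! ### Sufficiency and necessity -/

section

variable (μ : Measure (Set.Ico (0 : ℝ) 1)) [IsFiniteMeasure μ]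

/-- Bloch balls are closed under normal convergence, so the image is itself compact, not only
relatively compact. -/
lemma isCompact_cesaro_image {α p : ℝ} [hp : Fact (1 ≤ p)] (hα : 0 < α)
    (hmaj : majorantIntegral μ α p < ∞) (M : ℝ) :
    IsCompact {g : Besov p | ∃ f ∈ blochBall M, Besov.toHol p g = cesaroHol μ α f} := by
  refine IsSeqCompact.isCompact fun u hu => ?_
  choose f hf huf using hu
  obtain ⟨g, hg, φ, hφ, hconv⟩ := exists_subseq_normalConvergence f hf
  let v : Besov p := (⟨cesaroHol μ α g, besovIntegral_cesaroHol_lt_top μ hα hp.out hmaj hg⟩ :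
    besovSubmodule p)
  refine ⟨v, ⟨g, hg, rfl⟩, φ, hφ, ?_⟩
  rw [tendsto_iff_norm_sub_tendsto_zero]
  have h := tendsto_besovNorm_sub μ hα hp.out hmaj (fun n => hf (φ n)) hg hconv
  refine h.congr fun n => ?_
  change _ = besovNorm p (Besov.toHol p (u (φ n) - v))
  rw [map_sub, huf]
  rfl

lemma cesaroCompact_of_summable {α p : ℝ} [hp : Fact (1 ≤ p)] (hα : 0 < α) (hαp : 1 ≤ p * α)
    {X : Type*} [NormedAddCommGroup X] [NormedSpace ℂ X] [CompleteSpace X]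
    (ι : X →ₗ[ℂ] Hol) (hι : IsAnalyticFunctionSpace ι) (hB : Set.range ι ⊆ bloch)
    (hs : Summable fun n : ℕ => ((n : ℝ) + 1) ^ (p * α - 1) * moment μ n ^ p *
      Real.log ((n : ℝ) + 2) ^ p) : CesaroCompact ι μ α p := by
  have hmaj : majorantIntegral μ α p < ∞ :=
    lintegral_majorant_lt_top μ hp.out (by rwa [mul_comm]) (one_lt_besovOrder_mul hp.out)
      (summable_tail_of_condensed μ hp.out (summable_condensed μ hp.out hαp hs))
  have hfin : ∀ x, (cesaroHol μ α ∘ₗ ι) x ∈ besovSubmodule p := fun x => by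
    obtain ⟨M, hM⟩ := exists_mem_blochBall_of_mem_bloch (hB ⟨x, rfl⟩)
    exact besovIntegral_cesaroHol_lt_top μ hα hp.out hmaj hM
  let T : X →ₗ[ℂ] Besov p := (cesaroHol μ α ∘ₗ ι).codRestrict (besovSubmodule p) hfin
  have hT : ∀ x, Besov.toHol p (T x) = cesaroHol μ α (ι x) := fun x => rfl
  obtain ⟨M, hM⟩ := exists_forall_mem_blochBall hι hB
  have hcomp : IsCompactOperator T := by
    refine ⟨_, isCompact_cesaro_image μ hα hmaj M,
      mem_of_superset (Metric.closedBall_mem_nhds 0 one_pos) fun x hx => ?_⟩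
    exact ⟨ι x, hM x (mem_closedBall_zero_iff.1 hx), hT x⟩
  -- Continuity comes for free: a linear map that sends a neighbourhood of 0 into a compact set is
  -- bounded.
  refine ⟨ContinuousLinearMap.mkOfIsCompactOperator hcomp, fun x z hz => ?_, hcomp⟩
  rw [cesaro_eq_cesaroIntegral μ hα _ hz, ← cesaroHol_apply μ α _ hz, ← hT]
  rfl

/-- Only the membership in `B_p` of the image of one function, `logHol`, is needed; no norm estimate
for the operator is used. -/
lemma summable_of_cesaroBounded {α s p : ℝ} [hp : Fact (1 ≤ p)] (hα : 0 < α) (hs : 1 < s)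
    (hαp : 1 ≤ p * α) {X : Type*} [NormedAddCommGroup X] [NormedSpace ℂ X]
    (ι : X →ₗ[ℂ] Hol) (hΛ : meanLipschitz s (1 / s) ⊆ Set.range ι) (h : CesaroBounded ι μ α p) :
    Summable fun n : ℕ => ((n : ℝ) + 1) ^ (p * α - 1) * moment μ n ^ p *
      Real.log ((n : ℝ) + 2) ^ p := by
  obtain ⟨T, hT⟩ := h
  obtain ⟨x, hx⟩ := hΛ (logHol_mem_meanLipschitz hs)
  refine summable_of_condensed μ hp.out hαp (summable_condensed_of_besovIntegral_lt_top μ hα hp.out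
    (Besov.toHol p (T x)) (fun z hz => ?_) (T x).2)
  rw [hT x z hz, hx, cesaro_eq_cesaroIntegral μ hα _ hz]

end

end CesaroBesov

end

theorem theorem1p1 (α s p : ℝ) (hα : 0 < α) (hs : 1 < s) [Fact (1 ≤ p)] (hp : max 1 (1 / α) ≤ p)
    (μ : MeasureTheory.Measure (Set.Ico (0 : ℝ) 1)) [MeasureTheory.IsFiniteMeasure μ]
    {X : Type*} [NormedAddCommGroup X] [NormedSpace ℂ X] [CompleteSpace X]
    (ι : X →ₗ[ℂ] CesaroBesov.Hol) (hι : CesaroBesov.IsAnalyticFunctionSpace ι)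
    (hΛ : CesaroBesov.meanLipschitz s (1 / s) ⊆ Set.range ι)
    (hB : Set.range ι ⊆ CesaroBesov.bloch) :
    List.TFAE [
      CesaroBesov.CesaroBounded ι μ α p,
      CesaroBesov.CesaroCompact ι μ α p,
      Summable fun n : ℕ => ((n : ℝ) + 1) ^ (p * α - 1) * CesaroBesov.moment μ n ^ p *
        Real.log ((n : ℝ) + 2) ^ p] := by
  have hαp : 1 ≤ p * α := (div_le_iff₀ hα).1 ((le_max_right _ _).trans hp)
  tfae_have 2 → 1 := fun ⟨T, hT, _⟩ => ⟨T, hT⟩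
  tfae_have 1 → 3 := CesaroBesov.summable_of_cesaroBounded μ hα hs hαp ι hΛ
  tfae_have 3 → 2 := CesaroBesov.cesaroCompact_of_summable μ hα hαp ι hι hB
  tfae_finish
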